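/- Let $\xi_0,\xi_1,\dots$ be i.i.d. exponential random variables of parameter $1$, let $P_n(z)=\sum_{j=0}^n\xi_jz^j$, and let $L_n=\frac1n\sum_{i=1}^n\delta_{z_i}$ be the empirical measure of the complex zeros $z_1,\dots,z_n$ of $P_n$ (counted with multiplicity), $n\ge1$. For a closed set $S\subset\mathbb C$ let $\mathcal M_1(S)\subset\mathcal M_1(\mathbb C)$ be the set of Borel probability measures on $\mathbb C$ carried by $S$, with the topology of weak convergence; let $\mathbb R_-=(-\infty,0]$. Let $\mathcal P\subset\mathcal M_1(\mathbb C)$ be the weak closure of the set of empirical measures of zeros of nonconstant polynomials all of whose coefficients are real and strictly positive, and define $I:\mathcal M_1(\mathbb C)\to[0,\infty]$ by $$I(\mu)=\int\log|1-z|\,d\mu(z)-\tfrac12\iint\log|z-w|\,d\mu(z)d\mu(w)\quad(\mu\in\mathcal P),\qquad I(\mu)=\infty\quad(\mu\notin\mathcal P),$$ where the right-hand side is understood as $\frac12\iint\big(\log|1-z|+\log|1-w|-\log|z-w|\big)d\mu(z)d\mu(w)\in(-\infty,\infty]$. Put $I_R=\inf_{\mu\in\mathcal M_1(\mathbb R_-)}I(\mu)$.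 Then $\mathbb P(L_n\in\mathcal M_1(\mathbb R_-))>0$ for all $n\ge1$, and, conditioned on $L_n\in\mathcal M_1(\mathbb R_-)$, the random measures $L_n$ satisfy the large deviation principle in $\mathcal M_1(\mathbb R_-)$ with speed $n^2$ and good rate function $J(\mu)=I(\mu)-I_R$. That is, $J$ is nonnegative and lower semicontinuous on $\mathcal M_1(\mathbb R_-)$, its level sets $\{J\le M\}$, $M\in\mathbb R$, are compact, and for every open $O\subset\mathcal M_1(\mathbb R_-)$ and every closed $F\subset\mathcal M_1(\mathbb R_-)$, $$\liminf_{n\to\infty}\frac1{n^2}\log\mathbb P\big(L_n\in O\mid L_n\in\mathcal M_1(\mathbb R_-)\big)\ge-\inf_OJ,\qquad \limsup_{n\to\infty}\frac1{n^2}\log\mathbb P\big(L_n\in F\mid L_n\in\mathcal M_1(\mathbb R_-)\big)\le-\inf_FJ.$$ Moreover there is exactly one $\mu_R\in\mathcal M_1(\mathbb R_-)$ with $I(\mu_R)=I_R$, and, conditioned on $L_n\in\mathcal M_1(\mathbb R_-)$, and likewise conditioned on $L_n\in\mathcal M_1(\mathbb R)$, $L_n$ converges weakly to $\mu_R$ in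 probability: for every weakly open $U\subset\mathcal M_1(\mathbb C)$ containing $\mu_R$, the conditional probability of $\{L_n\in U\}$ tends to $1$ as $n\to\infty$. -/

import Mathlib

open MeasureTheory ProbabilityTheory Filter Topology Polynomial
open scoped ENNReal

noncomputable section

namespace RandomZeros

/-- The complex zeros of a real polynomial, counted with multiplicity, each with mass
`1 / #zeros`. -/
def zeroMeasure (p : ℝ[X]) : Measure ℂ :=
  ((p.aroots ℂ).card : ℝ≥0∞)⁻¹ • ((p.aroots ℂ).map Measure.dirac).sum

theorem multiset_sum_dirac_univ (s : Multiset ℂ) :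
    (s.map Measure.dirac).sum Set.univ = (s.card : ℝ≥0∞) := by
  induction s using Multiset.induction_on with
  | empty => simp
  | cons a s ih => simp [ih, add_comm]

theorem isProbabilityMeasure_zeroMeasure {p : ℝ[X]} (hp : p.natDegree ≠ 0) :
    IsProbabilityMeasure (zeroMeasure p) := by
  have hcard : (p.aroots ℂ).card = p.natDegree := by
    have := (IsAlgClosed.splits (p.map (algebraMap ℝ ℂ))).natDegree_eq_card_roots
    rw [Polynomial.natDegree_map] at this
    exact this.symm
  constructor
  rw [zeroMeasure, Measure.smul_apply, multiset_sum_dirac_univ, hcard, smul_eq_mul]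
  exact ENNReal.inv_mul_cancel (by exact_mod_cast hp) (ENNReal.natCast_ne_top _)

/-- The empirical measure of zeros `μ_p`, as a point of `M₁(ℂ)`. A polynomial of degree `0` has
no empirical measure; the value `δ₀` there is a convention. -/
def empiricalMeasure (p : ℝ[X]) : ProbabilityMeasure ℂ :=
  if hp : p.natDegree ≠ 0 then ⟨zeroMeasure p, isProbabilityMeasure_zeroMeasure hp⟩
  else ⟨Measure.dirac 0, inferInstance⟩

/-- Nonconstant polynomials all of whose coefficients (up to the degree) are real and positive. -/
def polPos : Set ℝ[X] :=
  {p | p.natDegree ≠ 0 ∧ ∀ k ≤ p.natDegree, 0 < p.coeff k}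

/-- The weak closure `𝒫` in `M₁(ℂ)` of the empirical measures of polynomials with positive
coefficients. -/
def classP : Set (ProbabilityMeasure ℂ) := closure (empiricalMeasure '' polPos)

/-- Lebesgue integral of an extended real valued function, `∫ g⁺ - ∫ g⁻`. -/
def eintegral {α : Type*} [MeasurableSpace α] (μ : Measure α) (g : α → EReal) : EReal :=
  ((∫⁻ x, (g x).toENNReal ∂μ : ℝ≥0∞) : EReal) - ((∫⁻ x, (-g x).toENNReal ∂μ : ℝ≥0∞) : EReal)

/-- `f(z,w) = log|1-z| + log|1-w| - log|z-w|`, with `log 0 = -∞`; so `f(z,z) = +∞` for `z ≠ 1`. -/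
def logKernel (z w : ℂ) : EReal :=
  ENNReal.log ‖1 - z‖ₑ + ENNReal.log ‖1 - w‖ₑ - ENNReal.log ‖z - w‖ₑ

open Classical in
/-- `I(μ) = ∫ log|1-z| dμ(z) - ½ ∬ log|z-w| dμ(z)dμ(w)` on `𝒫`, understood as
`½ ∬ f(z,w) dμ(z)dμ(w)`, and `∞` off `𝒫`. -/
def rateI (μ : ProbabilityMeasure ℂ) : EReal :=
  if μ ∈ classP then
    eintegral ((μ : Measure ℂ).prod (μ : Measure ℂ)) (fun q => logKernel q.1 q.2) / 2
  else ⊤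

/-- The real line inside `ℂ`. -/
def realLine : Set ℂ := Set.range ((↑) : ℝ → ℂ)

/-- `ℝ₋ = ℝ \ (0,∞)` inside `ℂ`. -/
def negLine : Set ℂ := ((↑) : ℝ → ℂ) '' Set.Iic 0

/-- `M₁(S)` as a subset of `M₁(ℂ)`. -/
def probOn (S : Set ℂ) : Set (ProbabilityMeasure ℂ) :=
  {μ | (μ : Measure ℂ) Sᶜ = 0}

/-- `I_R`, the infimum of `I` over `M₁(ℝ₋)`. -/
def infRate : EReal := ⨅ μ ∈ probOn negLine, rateI μ

/-- A good rate function: lower semicontinuous, nonnegative, with compact level sets. -/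
def IsGoodRateFunction {E : Type*} [TopologicalSpace E] (J : E → EReal) : Prop :=
  LowerSemicontinuous J ∧ (∀ x, 0 ≤ J x) ∧ ∀ M : ℝ, IsCompact {x | J x ≤ (M : EReal)}

/-- The large deviation principle with speed `a n` and good rate function `J`, for laws given by
the probabilities `Q n A` of the sets `A ⊆ E`. -/
def SatisfiesLDP {E : Type*} [TopologicalSpace E] (Q : ℕ → Set E → ℝ≥0∞) (a : ℕ → ℝ)
    (J : E → EReal) : Prop :=
  IsGoodRateFunction J ∧
  (∀ O : Set E, IsOpen O →
    -(⨅ x ∈ O, J x) ≤ liminf (fun n => ENNReal.log (Q n O) / ((a n : ℝ) : EReal)) atTop) ∧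
  (∀ F : Set E, IsClosed F →
    limsup (fun n => ENNReal.log (Q n F) / ((a n : ℝ) : EReal)) atTop ≤ -(⨅ x ∈ F, J x))

/-- `P_n(z) = ∑_{j=0}^n ξ_j z^j`. -/
def randomPoly {Ω : Type*} (ξ : ℕ → Ω → ℝ) (n : ℕ) (ω : Ω) : ℝ[X] :=
  ∑ j ∈ Finset.range (n + 1), C (ξ j ω) * X ^ j

/-- `L_n`, the empirical measure of the zeros of `P_n`. -/
def empL {Ω : Type*} (ξ : ℕ → Ω → ℝ) (n : ℕ) (ω : Ω) : ProbabilityMeasure ℂ :=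
  empiricalMeasure (randomPoly ξ n ω)

/-- `ℙ(L_n ∈ A | L_n ∈ M₁(S))`. -/
def condProb {Ω : Type*} [MeasurableSpace Ω] (P : Measure Ω) (ξ : ℕ → Ω → ℝ) (S : Set ℂ) (n : ℕ)
    (A : Set (ProbabilityMeasure ℂ)) : ℝ≥0∞ :=
  (ProbabilityTheory.cond P {ω | empL ξ n ω ∈ probOn S}) {ω | empL ξ n ω ∈ A}

end RandomZeros

end

/-!
The map `z ↦ 1 / (1 - z)` sends the negative half-line to `(0, 1]`. A polynomial with positive
coefficients and real zeros is `S ∏ (1 - yᵢ + yᵢ X)`, with `yᵢ` the images of its zeros and `S` the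
sum of its coefficients. The Jacobian of the coefficients in the coordinates `(S, y)` is
`Sⁿ ∏_{i<j} |yᵢ - yⱼ|`, and the joint density of the coefficients depends on `S` only; integrating
`S` out, the zeros form a log-gas on `[0, 1]` whose weight is the Vandermonde determinant. The upper
bound of the large deviation principle follows by truncating the kernel `-log |x - y|`, the lower
bound by placing points in small disjoint boxes around a configuration of nearly minimal energy.

The minimiser is unique because the energy is strictly convex: on `(0, 1]`, `-log u` is a mixture of
the tents `(1 - u eᵗ)₊`, `t ≥ 0`, and the tent at `u = |x - y|` is proportional to the measure of
the set of `z` whose window `(z, z + e⁻ᵗ]` contains both `x` and `y`, so the energy is a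
superposition of the squares of the masses of windows.
-/

noncomputable section

namespace RandomZeros

/-! ### The generating polynomial of independent Bernoulli variables -/

section BernoulliPGF

variable {ι R : Type*} [CommRing R]

/-- The probability generating function of a sum of independent Bernoulli variables with success
probabilities `y i`, `i ∈ s`: the polynomial with value `1` at `1` and zeros `1 - 1 / y i`. -/
def bernoulliPGF (s : Finset ι) (y : ι → R) : R[X] := ∏ i ∈ s, (C (1 - y i) + C (y i) * X)

theorem natDegree_bernoulliFactor_le (a : R) : (C (1 - a) + C a * X).natDegree ≤ 1 := by
  rw [add_comm]
  exact natDegree_linear_le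

theorem natDegree_bernoulliPGF_le (s : Finset ι) (y : ι → R) :
    (bernoulliPGF s y).natDegree ≤ s.card := by
  refine (natDegree_prod_le _ _).trans ?_
  simpa using Finset.sum_le_card_nsmul s _ 1 fun i _ => natDegree_bernoulliFactor_le (y i)

theorem eval_bernoulliPGF (s : Finset ι) (y : ι → R) (t : R) :
    (bernoulliPGF s y).eval t = ∏ i ∈ s, (1 - y i + y i * t) := by
  simp [bernoulliPGF, eval_prod]

theorem eval_homogenize_bernoulliPGF (s : Finset ι) (y : ι → R) (x : Fin 2 → R) :
    MvPolynomial.eval x ((bernoulliPGF s y).homogenize s.card) =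
      ∏ i ∈ s, ((1 - y i) * x 1 + y i * x 0) := by
  rw [bernoulliPGF, Finset.card_eq_sum_ones,
    homogenize_finsetProd fun i _ => natDegree_bernoulliFactor_le (y i), map_prod]
  exact Finset.prod_congr rfl fun i _ => by simp [homogenize_C_mul, sub_mul]

theorem bernoulliPGF_insert [DecidableEq ι] {s : Finset ι} {i : ι} (hi : i ∉ s) (y : ι → R) :
    bernoulliPGF (insert i s) y =
      C (1 - y i) * bernoulliPGF s y + C (y i) * (X * bernoulliPGF s y) := by
  rw [bernoulliPGF, Finset.prod_insert hi, add_mul, mul_assoc]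
  rfl

theorem coeff_bernoulliPGF_pos [LinearOrder R] [IsStrictOrderedRing R] {y : ι → R} {s : Finset ι}
    (hy : ∀ i ∈ s, y i ∈ Set.Ioo 0 1) {k : ℕ} (hk : k ≤ s.card) :
    0 < (bernoulliPGF s y).coeff k := by
  classical
  induction s using Finset.induction_on generalizing k with
  | empty => simp_all [bernoulliPGF]
  | insert a s ha ih =>
    obtain ⟨⟨h0, h1⟩, hys⟩ := Finset.forall_mem_insert _ _ _ |>.1 hy
    rw [Finset.card_insert_of_notMem ha] at hk
    rw [bernoulliPGF_insert ha, coeff_add, coeff_C_mul, coeff_C_mul]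
    rcases k with _ | k
    · simpa using mul_pos (sub_pos.2 h1) (ih hys (Nat.zero_le _))
    · have hX : 0 < y a * (X * bernoulliPGF s y).coeff (k + 1) := by
        rw [coeff_X_mul]
        exact mul_pos h0 (ih hys (by omega))
      refine add_pos_of_nonneg_of_pos (mul_nonneg (sub_pos.2 h1).le ?_) hX
      rcases Nat.lt_or_ge s.card (k + 1) with hlt | hle
      · exact (coeff_eq_zero_of_natDegree_lt
          ((natDegree_bernoulliPGF_le s y).trans_lt hlt)).ge
      · exact (ih hys hle).le

theorem bernoulliPGF_eq_prod_X_sub_C {K : Type*} [Field K] {s : Finset ι} {y : ι → K}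
    (hy : ∀ i ∈ s, y i ≠ 0) :
    bernoulliPGF s y = C (∏ i ∈ s, y i) * ∏ i ∈ s, (X - C (1 - 1 / y i)) := by
  rw [map_prod, ← Finset.prod_mul_distrib]
  refine Finset.prod_congr rfl fun i hi => ?_
  rw [mul_sub, ← C_mul, mul_sub, mul_one, mul_one_div_cancel (hy i hi), ← neg_sub (1 : K), C_neg]
  ring

end BernoulliPGF

/-! ### The Jacobian of the coefficients -/

section Jacobian

variable {R : Type*} [CommRing R]

/-- The coefficients of `v₀ ∏ (1 - yᵢ + yᵢ X)` as a function of `v = (v₀, y)`. -/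
def coeffMap (n : ℕ) (v : Fin (n + 1) → R) : Fin (n + 1) → R :=
  toFn (n + 1) (C (v 0) * bernoulliPGF Finset.univ (Fin.tail v))

/-- The partial derivatives of `v₀ ∏ (1 - yᵢ + yᵢ X)` in the coordinates `v = (v₀, y)`. -/
def jacobianPoly {n : ℕ} (v : Fin (n + 1) → R) : Fin (n + 1) → R[X] :=
  Fin.cons (bernoulliPGF Finset.univ (Fin.tail v)) fun i =>
    C (v 0) * ((X - 1) * bernoulliPGF {i}ᶜ (Fin.tail v))

/-- The Jacobian matrix of `coeffMap`. -/
def jacobianMatrix {n : ℕ} (v : Fin (n + 1) → R) : Matrix (Fin (n + 1)) (Fin (n + 1)) R :=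
  Matrix.of fun k c => (jacobianPoly v c).coeff k

theorem natDegree_X_sub_one_mul_bernoulliPGF_le {n : ℕ} (y : Fin n → R) (i : Fin n) :
    ((X - 1) * bernoulliPGF {i}ᶜ y).natDegree ≤ n := by
  have hX : (X - 1 : R[X]).natDegree ≤ 1 := by simpa using natDegree_X_sub_C_le (1 : R)
  have hdeg := natDegree_bernoulliPGF_le {i}ᶜ y
  rw [Finset.card_compl, Fintype.card_fin, Finset.card_singleton] at hdeg
  have := i.pos
  exact natDegree_mul_le.trans (by omega)

theorem natDegree_jacobianPoly_le {n : ℕ} (v : Fin (n + 1) → R) (c : Fin (n + 1)) :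
    (jacobianPoly v c).natDegree ≤ n := by
  induction c using Fin.cases with
  | zero => simpa [jacobianPoly] using natDegree_bernoulliPGF_le Finset.univ (Fin.tail v)
  | succ i =>
    exact (natDegree_C_mul_le _ _).trans (natDegree_X_sub_one_mul_bernoulliPGF_le _ i)

theorem projVandermonde_mul_coeff {n : ℕ} {κ : Type*} (x w : Fin (n + 1) → R) (p : κ → R[X]) :
    (Matrix.projVandermonde x w * Matrix.of fun (k : Fin (n + 1)) c => (p c).coeff k :
      Matrix (Fin (n + 1)) κ R) =
      Matrix.of fun i c => MvPolynomial.eval ![x i, w i] ((p c).homogenize n) := by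
  ext i c
  simp only [Matrix.mul_apply, Matrix.of_apply, Matrix.projVandermonde_apply, homogenize, map_sum,
    Finset.Nat.sum_antidiagonal_eq_sum_range_succ_mk, Finset.sum_range]
  refine Finset.sum_congr rfl fun k _ => ?_
  rw [MvPolynomial.eval_monomial, Finsupp.update_eq_add_single (by simp),
    Finsupp.prod_add_index' (by simp) (by simp [pow_add]), Finsupp.prod_single_index (by simp),
    Finsupp.prod_single_index (by simp)]
  simp only [Matrix.cons_val_zero, Matrix.cons_val_one, Fin.val_rev]
  rw [Nat.add_sub_add_right, mul_comm]

theorem eval_homogenize_jacobianPoly_zero {n : ℕ} (v : Fin (n + 1) → R) (x : Fin 2 → R) :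
    MvPolynomial.eval x ((jacobianPoly v 0).homogenize n) =
      ∏ j : Fin n, ((1 - v j.succ) * x 1 + v j.succ * x 0) := by
  have := eval_homogenize_bernoulliPGF Finset.univ (Fin.tail v) x
  rwa [Finset.card_univ, Fintype.card_fin] at this

theorem eval_homogenize_jacobianPoly_succ {n : ℕ} (v : Fin (n + 1) → R) (c : Fin n)
    (x : Fin 2 → R) :
    MvPolynomial.eval x ((jacobianPoly v c.succ).homogenize n) =
      v 0 * ((x 0 - x 1) * ∏ j ∈ {c}ᶜ, ((1 - v j.succ) * x 1 + v j.succ * x 0)) := by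
  have hn : n = 1 + ({c}ᶜ : Finset (Fin n)).card := by
    rw [Finset.card_compl, Fintype.card_fin, Finset.card_singleton]
    have := c.pos
    omega
  have hmul := homogenize_mul (X - 1 : R[X]) (bernoulliPGF {c}ᶜ (Fin.tail v))
    (by simpa using natDegree_X_sub_C_le (1 : R)) (natDegree_bernoulliPGF_le _ _)
  rw [← hn] at hmul
  rw [jacobianPoly, Fin.cons_succ, homogenize_C_mul, hmul, map_mul, map_mul,
    eval_homogenize_bernoulliPGF]
  simp [Fin.tail]

/-- The projective nodes `1 = (1 : 1)` and `1 - 1 / yᵢ = (yᵢ - 1 : yᵢ)` diagonalise the Jacobian. -/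
theorem projVandermonde_mul_jacobianMatrix {n : ℕ} (v : Fin (n + 1) → R) :
    Matrix.projVandermonde (Fin.cons 1 fun i => v i.succ - 1) (Fin.cons 1 (Fin.tail v)) *
      jacobianMatrix v = Matrix.diagonal (Fin.cons 1 fun i =>
        -v 0 * ∏ j ∈ {i}ᶜ, (v i.succ - v j.succ)) := by
  rw [jacobianMatrix, projVandermonde_mul_coeff]
  ext i c
  induction i using Fin.cases with
  | zero =>
    induction c using Fin.cases with
    | zero => simp [eval_homogenize_jacobianPoly_zero]
    | succ c => simp [eval_homogenize_jacobianPoly_succ, (Fin.succ_ne_zero c).symm]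
  | succ i =>
    have hfactor : ∀ j : Fin n, (1 - v j.succ) * v i.succ + v j.succ * (v i.succ - 1) =
        v i.succ - v j.succ := fun j => by ring
    induction c using Fin.cases with
    | zero =>
      simpa [eval_homogenize_jacobianPoly_zero, hfactor, Fin.tail, Fin.succ_ne_zero i] using
        Finset.prod_eq_zero (Finset.mem_univ i) (sub_self (v i.succ))
    | succ c =>
      rcases eq_or_ne i c with rfl | hic
      · simp [eval_homogenize_jacobianPoly_succ, hfactor, Fin.tail]
      · rw [Matrix.diagonal_apply_ne _ (Fin.succ_injective _ |>.ne hic), Matrix.of_apply,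
          eval_homogenize_jacobianPoly_succ]
        simp only [Fin.cons_succ, Fin.tail, Matrix.cons_val_zero, Matrix.cons_val_one, hfactor]
        rw [Finset.prod_eq_zero (i := i) (by simpa using hic) (sub_self _), mul_zero, mul_zero]

theorem det_jacobianMatrix_eq_zero {n : ℕ} {v : Fin (n + 1) → R}
    (hv : ¬ Function.Injective (Fin.tail v)) : (jacobianMatrix v).det = 0 := by
  obtain ⟨i, j, hij, hne⟩ := Function.not_injective_iff.1 hv
  refine Matrix.det_zero_of_column_eq (Fin.succ_injective _ |>.ne hne) fun k => ?_
  have hcomp : bernoulliPGF {i}ᶜ (Fin.tail v) = bernoulliPGF {j}ᶜ (Fin.tail v) := by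
    refine Finset.prod_equiv (Equiv.swap i j)
      (fun k => by simp [Equiv.swap_apply_eq_iff]) fun k _ => ?_
    rw [← Function.comp_apply (f := Fin.tail v) (g := Equiv.swap i j), Equiv.comp_swap_eq_update,
      hij, Function.update_eq_self, ← hij, Function.update_eq_self]
  simp only [jacobianMatrix, jacobianPoly, Matrix.of_apply, Fin.cons_succ, hcomp]

theorem det_projVandermonde_cons_one {n : ℕ} (y : Fin n → R) :
    (Matrix.projVandermonde (Fin.cons 1 fun i => y i - 1 : Fin (n + 1) → R) (Fin.cons 1 y)).det =
      (-1) ^ n * (Matrix.vandermonde y).det := by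
  rw [Matrix.det_projVandermonde, Matrix.det_vandermonde, Fin.prod_univ_succ]
  simp only [Fin.prod_Ioi_zero, Fin.prod_Ioi_succ, Fin.cons_zero, Fin.cons_succ]
  congr 1
  · simp
  · exact Finset.prod_congr rfl fun i _ => Finset.prod_congr rfl fun j _ => by ring

theorem abs_det_jacobianMatrix [LinearOrder R] [IsStrictOrderedRing R] {n : ℕ}
    (v : Fin (n + 1) → R) :
    |(jacobianMatrix v).det| = |v 0| ^ n * |(Matrix.vandermonde (Fin.tail v)).det| := by
  by_cases hinj : Function.Injective (Fin.tail v)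
  · have hV := Matrix.det_vandermonde_ne_zero_iff.2 hinj
    have hdiag : |∏ i : Fin n, ∏ j ∈ {i}ᶜ, (v i.succ - v j.succ)| =
        |(Matrix.vandermonde (Fin.tail v)).det| ^ 2 := by
      rw [Matrix.det_vandermonde, ← Finset.prod_prod_Ioi_mul_eq_prod_prod_off_diag
        (fun j i : Fin n => v i.succ - v j.succ)]
      simp only [Finset.abs_prod, Fin.tail, abs_mul, sq, ← Finset.prod_mul_distrib]
      exact Finset.prod_congr rfl fun i _ => Finset.prod_congr rfl fun j _ => by
        rw [abs_sub_comm]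
    have hdet := congrArg (fun M => |Matrix.det M|) (projVandermonde_mul_jacobianMatrix v)
    simp only [Matrix.det_mul, Matrix.det_diagonal, abs_mul, Fin.prod_univ_succ, Fin.cons_zero,
      Fin.cons_succ, one_mul, Finset.prod_mul_distrib, hdiag, Finset.prod_const,
      Finset.card_univ, Fintype.card_fin, abs_pow, abs_neg] at hdet
    rw [show (fun i : Fin n => v i.succ - 1) = fun i => Fin.tail v i - 1 from rfl,
      det_projVandermonde_cons_one, abs_mul, abs_pow, abs_neg, abs_one, one_pow, one_mul, sq,
      ← mul_assoc, mul_comm] at hdet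
    exact mul_right_cancel₀ (abs_ne_zero.2 hV) hdet
  · rw [det_jacobianMatrix_eq_zero hinj,
      not_ne_iff.1 (mt Matrix.det_vandermonde_ne_zero_iff.1 hinj), abs_zero, mul_zero]

end Jacobian

/-- Evaluation at finitely many points determines the coefficients, by Lagrange interpolation. -/
theorem hasFDerivAt_toFn_of_eval {𝕜 E : Type*} [NontriviallyNormedField 𝕜] [CompleteSpace 𝕜]
    [NormedAddCommGroup E] [NormedSpace 𝕜 E] [FiniteDimensional 𝕜 E] {n : ℕ} {p : E → 𝕜[X]}
    {p' : E →ₗ[𝕜] 𝕜[X]} {x : E} (hp : ∀ v, (p v).natDegree ≤ n) (hp' : ∀ h, (p' h).natDegree ≤ n)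
    (heval : ∀ t, HasFDerivAt (fun v => (p v).eval t)
      (LinearMap.toContinuousLinearMap (leval t ∘ₗ p')) x) :
    HasFDerivAt (fun v => toFn (n + 1) (p v))
      (LinearMap.toContinuousLinearMap (toFn (n + 1) ∘ₗ p')) x := by
  have := NontriviallyNormedField.infinite 𝕜
  let t : ℕ → 𝕜 := Infinite.natEmbedding 𝕜
  have hinterp : ∀ {q : 𝕜[X]}, q.natDegree ≤ n → ∀ j, q.coeff j =
      ∑ k ∈ Finset.range (n + 1),
        q.eval (t k) * (Lagrange.basis (Finset.range (n + 1)) t k).coeff j := by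
    intro q hq j
    have hq' : q.degree < (Finset.range (n + 1)).card := by
      rw [Finset.card_range]
      exact degree_le_natDegree.trans_lt (by exact_mod_cast Nat.lt_succ_of_le hq)
    conv_lhs => rw [Lagrange.eq_interpolate ((Infinite.natEmbedding 𝕜).injective.injOn) hq']
    simp [Lagrange.interpolate_apply, t]
  rw [hasFDerivAt_pi']
  intro j
  change HasFDerivAt (fun v => (p v).coeff j) _ x
  simp only [hinterp (hp _)]
  refine (HasFDerivAt.fun_sum fun k _ => (heval (t k)).mul_const _).congr_fderiv ?_
  ext h
  simpa [mul_comm, toFn] using (hinterp (hp' h) j).symm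

theorem hasFDerivAt_coeffMap {n : ℕ} (v : Fin (n + 1) → ℝ) :
    HasFDerivAt (coeffMap n)
      (LinearMap.toContinuousLinearMap (Matrix.toLin' (jacobianMatrix v))) v := by
  let p' : (Fin (n + 1) → ℝ) →ₗ[ℝ] ℝ[X] := Fintype.linearCombination ℝ (jacobianPoly v)
  have hp' : ∀ h, p' h = ∑ c, h c • jacobianPoly v c := Fintype.linearCombination_apply ℝ _
  have hmatrix : Matrix.toLin' (jacobianMatrix v) = toFn (n + 1) ∘ₗ p' := by
    ext c k
    simp [hp', jacobianMatrix, Pi.single_apply]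
    rfl
  rw [hmatrix]
  refine hasFDerivAt_toFn_of_eval (fun w => (natDegree_C_mul_le _ _).trans ?_) (fun h => ?_)
    fun t => ?_
  · simpa using natDegree_bernoulliPGF_le Finset.univ (Fin.tail w)
  · rw [hp']
    exact natDegree_sum_le_of_forall_le _ _ fun c _ =>
      (natDegree_smul_le _ _).trans (natDegree_jacobianPoly_le v c)
  · have hproj : ∀ c : Fin (n + 1), HasFDerivAt (fun w : Fin (n + 1) → ℝ => w c)
        (ContinuousLinearMap.proj (R := ℝ) (φ := fun _ => ℝ) c) v := fun c => hasFDerivAt_apply c v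
    have hprod := (hproj 0).mul (HasFDerivAt.finsetProd (u := Finset.univ)
      fun (i : Fin n) _ => ((hproj i.succ).const_sub 1).add ((hproj i.succ).mul_const t))
    simp only [eval_mul, eval_C, eval_bernoulliPGF, Fin.tail]
    refine hprod.congr_fderiv ?_
    ext h
    simp only [hp', jacobianPoly, Fin.sum_univ_succ, Fin.cons_zero, Fin.cons_succ,
      add_apply, smul_apply, sum_apply,
      neg_apply, ContinuousLinearMap.proj_apply, smul_eq_mul, Finset.mul_sum,
      LinearMap.coe_toContinuousLinearMap', LinearMap.comp_apply, leval_apply, eval_add, eval_smul,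
      eval_finsetSum, eval_mul, eval_C, eval_sub, eval_X, eval_one, eval_bernoulliPGF, Fin.tail,
      Pi.add_apply, Finset.compl_eq_univ_sdiff, Finset.sdiff_singleton_eq_erase]
    rw [add_comm, mul_comm (h 0)]
    congr 1
    exact Finset.sum_congr rfl fun i _ => by ring

/-! ### Real-rooted polynomials with positive coefficients -/

section Roots

variable {ι K : Type*} [Field K]

theorem splits_C_mul_bernoulliPGF (c : K) {s : Finset ι} {y : ι → K} (hy : ∀ i ∈ s, y i ≠ 0) :
    (C c * bernoulliPGF s y).Splits := by
  rw [bernoulliPGF_eq_prod_X_sub_C hy]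
  exact (Splits.C c).mul ((Splits.C _).mul (Splits.prod fun i _ => Splits.X_sub_C _))

theorem roots_C_mul_bernoulliPGF {c : K} (hc : c ≠ 0) {s : Finset ι} {y : ι → K}
    (hy : ∀ i ∈ s, y i ≠ 0) :
    (C c * bernoulliPGF s y).roots = s.val.map fun i => 1 - 1 / y i := by
  rw [bernoulliPGF_eq_prod_X_sub_C hy, roots_C_mul _ hc,
    roots_C_mul _ (Finset.prod_ne_zero_iff.2 hy),
    roots_prod _ _ (Finset.prod_ne_zero_iff.2 fun i _ => X_sub_C_ne_zero _)]
  simp only [roots_X_sub_C, Multiset.bind_singleton]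

theorem aroots_C_mul_bernoulliPGF (L : Type*) [Field L] [Algebra K L] {c : K} (hc : c ≠ 0)
    {s : Finset ι} {y : ι → K} (hy : ∀ i ∈ s, y i ≠ 0) :
    (C c * bernoulliPGF s y).aroots L = s.val.map fun i => algebraMap K L (1 - 1 / y i) := by
  rw [aroots, (splits_C_mul_bernoulliPGF c hy).roots_map, roots_C_mul_bernoulliPGF hc hy,
    Multiset.map_map]
  rfl

theorem exists_univ_val_map_eq {α : Type*} (s : Multiset α) :
    ∃ x : Fin s.card → α, Finset.univ.val.map x = s := by
  induction s using Quotient.inductionOn with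
  | h l => exact ⟨l.get, (Fin.univ_val_map l.get).trans (congrArg _ (List.ofFn_get l))⟩

theorem neg_of_mem_roots {R : Type*} [CommRing R] [LinearOrder R] [IsStrictOrderedRing R]
    {p : R[X]} (h0 : 0 < p.coeff 0) (hp : ∀ k, 0 ≤ p.coeff k) {x : R} (hx : x ∈ p.roots) :
    x < 0 := by
  by_contra! hx0
  refine (isRoot_of_mem_roots hx).not_gt ?_
  rw [eval_eq_sum_range]
  exact Finset.sum_pos' (fun k _ => mul_nonneg (hp k) (pow_nonneg hx0 k))
    ⟨0, by simp, by simpa using h0⟩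

theorem exists_eq_C_mul_bernoulliPGF [LinearOrder K] [IsStrictOrderedRing K] {p : K[X]} {n : ℕ}
    (hn : p.natDegree = n) (hpos : ∀ k ≤ n, 0 < p.coeff k) (hp : p.Splits) :
    ∃ c > 0, ∃ y : Fin n → K, Monotone y ∧ (∀ i, y i ∈ Set.Ioo 0 1) ∧
      p = C c * bernoulliPGF Finset.univ y := by
  obtain rfl : p.roots.card = n := hp.natDegree_eq_card_roots ▸ hn
  obtain ⟨r, hr⟩ := exists_univ_val_map_eq p.roots
  have hcoeff : ∀ k, 0 ≤ p.coeff k := fun k => by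
    rcases le_or_gt k p.roots.card with hk | hk
    · exact (hpos k hk).le
    · exact (coeff_eq_zero_of_natDegree_lt (hn ▸ hk)).ge
  have hr0 : ∀ i, r i < 0 := fun i => neg_of_mem_roots (hpos 0 (Nat.zero_le _)) hcoeff <|
    hr ▸ Multiset.mem_map_of_mem r (Finset.mem_univ_val i)
  have hone : ∀ i, 1 < 1 - r i := fun i => by linarith [hr0 i]
  let y : Fin p.roots.card → K := fun i => 1 / (1 - r i)
  have hy : ∀ i, y i ∈ Set.Ioo 0 1 := fun i =>
    have hpos := zero_lt_one.trans (hone i)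
    ⟨one_div_pos.2 hpos, (div_lt_one hpos).2 (hone i)⟩
  have hprod : 0 < ∏ i, y i := Finset.prod_pos fun i _ => (hy i).1
  have hlead : 0 < p.leadingCoeff := by
    rw [leadingCoeff, hn]
    exact hpos _ le_rfl
  refine ⟨p.leadingCoeff / ∏ i, y i, div_pos hlead hprod, y ∘ Tuple.sort y, Tuple.monotone_sort y,
    fun i => hy _, ?_⟩
  have hsort : bernoulliPGF Finset.univ (y ∘ Tuple.sort y) = bernoulliPGF Finset.univ y :=
    Equiv.prod_comp (Tuple.sort y) fun i => C (1 - y i) + C (y i) * X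
  rw [hsort, bernoulliPGF_eq_prod_X_sub_C fun i _ => (hy i).1.ne', ← mul_assoc, ← C_mul,
    div_mul_cancel₀ _ hprod.ne']
  conv_lhs => rw [hp.eq_prod_roots, ← hr, Multiset.map_map]
  simp [y, Finset.prod_eq_multiset_prod]

/-- Increasing configurations of `n` distinct points in `(0, 1)`. -/
def configs (n : ℕ) : Set (Fin n → ℝ) := {y | StrictMono y ∧ ∀ i, y i ∈ Set.Ioo 0 1}

/-- The coordinates `(s, y)` with total mass `s > 0` and configuration `y ∈ B`. -/
def coordDomain {n : ℕ} (B : Set (Fin n → ℝ)) : Set (Fin (n + 1) → ℝ) :=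
  {v | v 0 ∈ Set.Ioi 0 ∧ Fin.tail v ∈ B}

theorem ofFn_coeffMap {R : Type*} [CommRing R] [DecidableEq R] {n : ℕ} (v : Fin (n + 1) → R) :
    ofFn (n + 1) (coeffMap n v) = C (v 0) * bernoulliPGF Finset.univ (Fin.tail v) := by
  refine ofFn_comp_toFn_eq_id_of_natDegree_lt (Nat.lt_succ_of_le ?_)
  simpa using (natDegree_C_mul_le _ _).trans (natDegree_bernoulliPGF_le Finset.univ (Fin.tail v))

theorem injOn_coeffMap (n : ℕ) : Set.InjOn (coeffMap n) (coordDomain (configs n)) := by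
  classical
  rintro v ⟨hv0, hv, hv1⟩ w ⟨hw0, hw, hw1⟩ h
  have hpoly := congrArg (ofFn (n + 1)) h
  rw [ofFn_coeffMap, ofFn_coeffMap] at hpoly
  have hzero : v 0 = w 0 := by
    simpa [eval_bernoulliPGF] using congrArg (eval 1) hpoly
  have hroots := congrArg roots hpoly
  rw [roots_C_mul_bernoulliPGF (Set.mem_Ioi.1 hv0).ne' fun i _ => (hv1 i).1.ne',
    roots_C_mul_bernoulliPGF (Set.mem_Ioi.1 hw0).ne' fun i _ => (hw1 i).1.ne'] at hroots
  have hrange : Set.range (Fin.tail v) = Set.range (Fin.tail w) := by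
    simpa [Set.ext_iff] using
      congrArg (fun s => {x | x ∈ Multiset.map (fun r : ℝ => 1 / (1 - r)) s}) hroots
  rw [← Fin.cons_self_tail v, ← Fin.cons_self_tail w, hzero, (hv.range_inj hw).1 hrange]

theorem sum_coeffMap {R : Type*} [CommRing R] {n : ℕ} (v : Fin (n + 1) → R) :
    ∑ k, coeffMap n v k = v 0 := by
  have hdeg : (C (v 0) * bernoulliPGF Finset.univ (Fin.tail v)).natDegree < n + 1 :=
    Nat.lt_succ_of_le <| by
      simpa using (natDegree_C_mul_le _ _).trans
        (natDegree_bernoulliPGF_le Finset.univ (Fin.tail v))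
  have hsum := eval_eq_sum_range' hdeg 1
  simp only [one_pow, mul_one, Finset.sum_range] at hsum
  exact hsum.symm.trans (by simp [eval_bernoulliPGF])

theorem coeffMap_pos {n : ℕ} {v : Fin (n + 1) → ℝ} (hv : v ∈ coordDomain (configs n))
    (k : Fin (n + 1)) :
    0 < coeffMap n v k := by
  change 0 < (C (v 0) * bernoulliPGF Finset.univ (Fin.tail v)).coeff k
  rw [coeff_C_mul]
  exact mul_pos hv.1 (coeff_bernoulliPGF_pos (fun i _ => hv.2.2 i)
    (by simpa using Nat.lt_succ_iff.1 k.2))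

end Roots

/-! ### Change of variables -/

section Density

theorem lintegral_pi_prod {n : ℕ} {α : Fin n → Type*} [∀ i, MeasurableSpace (α i)]
    (μ : ∀ i, Measure (α i)) [∀ i, SigmaFinite (μ i)] {f : ∀ i, α i → ℝ≥0∞}
    (hf : ∀ i, Measurable (f i)) :
    ∫⁻ x, ∏ i, f i (x i) ∂Measure.pi μ = ∏ i, ∫⁻ t, f i t ∂μ i := by
  induction n with
  | zero => simp
  | succ n ih =>
    rw [← (measurePreserving_piFinSuccAbove μ 0).symm.lintegral_comp_emb
      (MeasurableEquiv.measurableEmbedding _)]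
    simp only [MeasurableEquiv.piFinSuccAbove_symm_apply, Fin.prod_univ_succ]
    have htail : Measurable fun x : ∀ i : Fin n, α i.succ => ∏ i : Fin n, f i.succ (x i) :=
      Finset.measurable_fun_prod _ fun i _ => (hf i.succ).comp (measurable_pi_apply i)
    rw [← ih (fun i => μ i.succ) fun i => hf i.succ]
    exact lintegral_prod_mul (μ := μ 0) (ν := .pi fun i => μ i.succ) (hf 0).aemeasurable
      htail.aemeasurable

theorem pi_withDensity {n : ℕ} {α : Fin n → Type*} [∀ i, MeasurableSpace (α i)]
    (μ : ∀ i, Measure (α i)) [∀ i, SigmaFinite (μ i)] {f : ∀ i, α i → ℝ≥0∞}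
    [∀ i, SigmaFinite ((μ i).withDensity (f i))] (hf : ∀ i, Measurable (f i)) :
    Measure.pi (fun i => (μ i).withDensity (f i)) =
      (Measure.pi μ).withDensity fun x => ∏ i, f i (x i) := by
  refine Measure.pi_eq fun s hs => ?_
  have hind : ∀ x, (Set.univ.pi s).indicator (fun x => ∏ i, f i (x i)) x =
      ∏ i, (s i).indicator (f i) (x i) := by
    intro x
    by_cases hx : x ∈ Set.univ.pi s
    · rw [Set.indicator_of_mem hx]
      exact Finset.prod_congr rfl fun i _ => (Set.indicator_of_mem (hx i trivial) _).symm
    · obtain ⟨i, hi⟩ : ∃ i, x i ∉ s i := by simpa using hx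
      rw [Set.indicator_of_notMem hx,
        Finset.prod_eq_zero (Finset.mem_univ i) (Set.indicator_of_notMem hi _)]
  rw [withDensity_apply _ (.univ_pi hs), ← lintegral_indicator (.univ_pi hs)]
  simp_rw [hind]
  rw [lintegral_pi_prod μ fun i => (hf i).indicator (hs i)]
  exact Finset.prod_congr rfl fun i _ => by
    rw [lintegral_indicator (hs i), withDensity_apply _ (hs i)]

theorem measurable_exponentialPDF (r : ℝ) : Measurable (exponentialPDF r) :=
  (measurable_exponentialPDFReal r).ennreal_ofReal

theorem hasLaw_pi_exponential {Ω : Type*} [MeasurableSpace Ω] {P : Measure Ω}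
    [IsProbabilityMeasure P] {r : ℝ} (hr : 0 < r) {ξ : ℕ → Ω → ℝ}
    (hlaw : ∀ j, HasLaw (ξ j) (expMeasure r) P) (hindep : iIndepFun ξ P) (m : ℕ) :
    HasLaw (fun ω (k : Fin m) => ξ k ω)
      ((volume : Measure (Fin m → ℝ)).withDensity fun x => ∏ i, exponentialPDF r (x i)) P := by
  have hmeas : ∀ k : Fin m, AEMeasurable (ξ k) P := fun k => (hlaw k).aemeasurable
  have : IsProbabilityMeasure ((volume : Measure ℝ).withDensity (exponentialPDF r)) :=
    isProbabilityMeasure_expMeasure hr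
  refine ⟨aemeasurable_pi_lambda _ hmeas, ?_⟩
  rw [(iIndepFun_iff_map_fun_eq_pi_map hmeas).1 (hindep.precomp Fin.val_injective), volume_pi,
    ← pi_withDensity _ fun _ => measurable_exponentialPDF r]
  exact congrArg _ (funext fun k => (hlaw k).map_eq)

theorem ae_pos_expMeasure (r : ℝ) : ∀ᵐ x ∂expMeasure r, 0 < x := by
  rw [ae_iff]
  simp only [not_lt]
  change (volume.withDensity (exponentialPDF r)) (Set.Iic 0) = 0
  rw [withDensity_apply _ measurableSet_Iic, setLIntegral_congr Iio_ae_eq_Iic.symm]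
  exact lintegral_exponentialPDF_of_nonpos le_rfl

/-- Together with `sum_coeffMap` and `abs_det_jacobianMatrix`, this makes the total mass of the
coefficients Gamma distributed and independent of the zeros. -/
theorem ofReal_pow_mul_prod_exponentialPDF {n : ℕ} {r : ℝ} (hr : 0 < r) {x : Fin (n + 1) → ℝ}
    (hx : ∀ i, 0 < x i) :
    ENNReal.ofReal ((∑ i, x i) ^ n) * ∏ i, exponentialPDF r (x i) =
      n.factorial * gammaPDF (n + 1) r (∑ i, x i) := by
  have hsum : 0 < ∑ i, x i := Finset.sum_pos (fun i _ => hx i) Finset.univ_nonempty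
  simp only [exponentialPDF_of_nonneg (hx _).le]
  rw [gammaPDF_of_nonneg hsum.le, Real.Gamma_nat_eq_factorial, ← ENNReal.ofReal_natCast,
    ← ENNReal.ofReal_prod_of_nonneg fun i _ => by positivity, ← ENNReal.ofReal_mul (by positivity),
    ← ENNReal.ofReal_mul (by positivity), Finset.prod_mul_distrib, ← Real.exp_sum,
    Finset.sum_neg_distrib, ← Finset.mul_sum, add_sub_cancel_right, Real.rpow_natCast,
    ← Nat.cast_succ, Real.rpow_natCast]
  congr 1
  simp only [Finset.prod_const, Finset.card_univ, Fintype.card_fin]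
  field_simp

theorem measurable_tail (n : ℕ) : Measurable (Fin.tail : (Fin (n + 1) → ℝ) → (Fin n → ℝ)) :=
  measurable_pi_lambda _ fun i => measurable_pi_apply i.succ

theorem measurableSet_coordDomain {n : ℕ} {B : Set (Fin n → ℝ)} (hB : MeasurableSet B) :
    MeasurableSet (coordDomain B) :=
  (measurable_pi_apply 0 measurableSet_Ioi).inter (measurable_tail n hB)

theorem coordDomain_mono {n : ℕ} {B B' : Set (Fin n → ℝ)} (h : B ⊆ B') :
    coordDomain B ⊆ coordDomain B' :=
  fun _ hv => ⟨hv.1, h hv.2⟩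

theorem measurableSet_image_coeffMap {n : ℕ} {B : Set (Fin n → ℝ)} (hB : MeasurableSet B)
    (hBn : B ⊆ configs n) : MeasurableSet (coeffMap n '' coordDomain B) :=
  measurable_image_of_fderivWithin (measurableSet_coordDomain hB)
    (fun v _ => (hasFDerivAt_coeffMap v).hasFDerivWithinAt)
    ((injOn_coeffMap n).mono (coordDomain_mono hBn))

theorem volume_image_coeffMap_not_injective (n : ℕ) :
    volume (coeffMap n '' {v : Fin (n + 1) → ℝ | ¬ Function.Injective (Fin.tail v)}) = 0 := by
  refine addHaar_image_eq_zero_of_det_fderivWithin_eq_zero volume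
    (fun v _ => (hasFDerivAt_coeffMap v).hasFDerivWithinAt) fun v hv => ?_
  rw [LinearMap.det_toContinuousLinearMap, LinearMap.det_toLin', det_jacobianMatrix_eq_zero hv]

theorem measurable_abs_det_vandermonde (n : ℕ) :
    Measurable fun y : Fin n → ℝ => ENNReal.ofReal |(Matrix.vandermonde y).det| := by
  simp only [Matrix.det_vandermonde]
  fun_prop

theorem lintegral_coordDomain_mul {n : ℕ} (B : Set (Fin n → ℝ)) {f : ℝ → ℝ≥0∞}
    {g : (Fin n → ℝ) → ℝ≥0∞} (hf : Measurable f) (hg : Measurable g) :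
    ∫⁻ v in coordDomain B, f (v 0) * g (Fin.tail v) =
      (∫⁻ t in Set.Ioi 0, f t) * ∫⁻ y in B, g y := by
  rw [← lintegral_prod_mul hf.aemeasurable hg.aemeasurable, Measure.prod_restrict]
  exact (volume_preserving_piFinSuccAbove (fun _ : Fin (n + 1) => ℝ)
    0).setLIntegral_comp_preimage_emb
    (MeasurableEquiv.measurableEmbedding _) (fun q => f q.1 * g q.2) (Set.Ioi 0 ×ˢ B)

theorem lintegral_Ioi_gammaPDF {a r : ℝ} (ha : 0 < a) (hr : 0 < r) :
    ∫⁻ t in Set.Ioi 0, gammaPDF a r t = 1 := by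
  have hsplit := lintegral_add_compl (μ := volume) (gammaPDF a r) (measurableSet_Ioi (a := 0))
  rwa [Set.compl_Ioi, ← setLIntegral_congr Iio_ae_eq_Iic, lintegral_gammaPDF_of_nonpos le_rfl,
    add_zero, lintegral_gammaPDF_eq_one ha hr] at hsplit

theorem lintegral_image_coeffMap {n : ℕ} {r : ℝ} (hr : 0 < r) {B : Set (Fin n → ℝ)}
    (hB : MeasurableSet B) (hBn : B ⊆ configs n) :
    ∫⁻ x in coeffMap n '' coordDomain B, ∏ i, exponentialPDF r (x i) =
      n.factorial * ∫⁻ y in B, ENNReal.ofReal |(Matrix.vandermonde y).det| := by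
  rw [lintegral_image_eq_lintegral_abs_det_fderiv_mul volume (measurableSet_coordDomain hB)
    (fun v _ => (hasFDerivAt_coeffMap v).hasFDerivWithinAt)
    ((injOn_coeffMap n).mono (coordDomain_mono hBn))]
  have hdensity : ∀ v ∈ coordDomain B, ENNReal.ofReal |(LinearMap.toContinuousLinearMap
      (Matrix.toLin' (jacobianMatrix v))).det| * ∏ i, exponentialPDF r (coeffMap n v i) =
      n.factorial * gammaPDF (n + 1) r (v 0) *
        ENNReal.ofReal |(Matrix.vandermonde (Fin.tail v)).det| := by
    intro v hv
    have hmass := ofReal_pow_mul_prod_exponentialPDF hr (coeffMap_pos (coordDomain_mono hBn hv))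
    rw [sum_coeffMap] at hmass
    rw [LinearMap.det_toContinuousLinearMap, LinearMap.det_toLin', abs_det_jacobianMatrix,
      abs_of_pos hv.1, ENNReal.ofReal_mul (pow_nonneg (Set.mem_Ioi.1 hv.1).le n), mul_right_comm,
      hmass]
  have hgamma : Measurable (gammaPDF (n + 1) r) := (measurable_gammaPDFReal _ r).ennreal_ofReal
  rw [setLIntegral_congr_fun (measurableSet_coordDomain hB) hdensity,
    lintegral_coordDomain_mul B (hgamma.const_mul _) (measurable_abs_det_vandermonde n),
    lintegral_const_mul _ hgamma, lintegral_Ioi_gammaPDF (by positivity) hr, mul_one]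

end Density

/-! ### Symmetrization -/

section Symmetrization

variable {α : Type*} [LinearOrder α] {n : ℕ}

theorem existsUnique_perm_strictMono_comp {y : Fin n → α} (hy : Function.Injective y) :
    ∃! σ : Equiv.Perm (Fin n), StrictMono (y ∘ σ) := by
  refine ⟨Tuple.sort y,
    (Tuple.monotone_sort y).strictMono_of_injective (hy.comp (Equiv.injective _)), fun τ hτ => ?_⟩
  exact Equiv.ext fun i =>
    hy (congrFun (Tuple.comp_sort_eq_comp_iff_monotone.2 hτ.monotone) i)

theorem lintegral_eq_factorial_mul_strictMono [MeasurableSpace α] {μ : Measure (Fin n → α)}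
    (hinj : ∀ᵐ y ∂μ, Function.Injective y)
    (hmeas : MeasurableSet {y : Fin n → α | StrictMono y})
    (hμ : ∀ σ : Equiv.Perm (Fin n), MeasurePreserving (fun y : Fin n → α => y ∘ σ) μ μ)
    {f : (Fin n → α) → ℝ≥0∞} (hfm : Measurable f)
    (hf : ∀ (σ : Equiv.Perm (Fin n)) y, f (y ∘ σ) = f y) :
    ∫⁻ y, f y ∂μ = n.factorial * ∫⁻ y in {y | StrictMono y}, f y ∂μ := by
  let S : Equiv.Perm (Fin n) → Set (Fin n → α) := fun σ => {y | StrictMono (y ∘ σ)}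
  have hmeasS : ∀ σ, MeasurableSet (S σ) := fun σ => (hμ σ).measurable hmeas
  have hcover : (⋃ σ, S σ) =ᵐ[μ] Set.univ := by
    filter_upwards [hinj] with y hy
    obtain ⟨σ, hσ, -⟩ := existsUnique_perm_strictMono_comp hy
    exact eq_true (Set.mem_iUnion.2 ⟨σ, hσ⟩)
  have hdisj : Pairwise fun σ τ => Disjoint (S σ) (S τ) := by
    refine fun σ τ hne => Set.disjoint_left.2 fun y hσ hτ => hne ?_
    have hy : Function.Injective y := hσ.injective.of_comp_right (Equiv.surjective σ)
    exact (existsUnique_perm_strictMono_comp hy).unique hσ hτ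
  have hpiece : ∀ σ, ∫⁻ y in S σ, f y ∂μ = ∫⁻ y in {y | StrictMono y}, f y ∂μ := by
    intro σ
    rw [← (hμ σ).setLIntegral_comp_preimage hmeas hfm]
    simp only [hf]
    rfl
  rw [← setLIntegral_univ, ← setLIntegral_congr hcover, lintegral_iUnion hmeasS hdisj, tsum_fintype,
    Finset.sum_congr rfl fun σ _ => hpiece σ, Finset.sum_const, Finset.card_univ,
    Fintype.card_perm, Fintype.card_fin, nsmul_eq_mul]

end Symmetrization

/-! ### Empirical measures -/

section EmpMeasure

variable {ι κ X Y : Type*} [Fintype ι] [Fintype κ] [MeasurableSpace X] [MeasurableSpace Y]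

theorem isProbabilityMeasure_inv_card_smul_sum_dirac [Nonempty ι] (y : ι → X) :
    IsProbabilityMeasure ((Fintype.card ι : ℝ≥0∞)⁻¹ • ∑ i, Measure.dirac (y i)) := by
  constructor
  simp [ENNReal.inv_mul_cancel]

variable [Nonempty X] [Nonempty Y]

open Classical in
/-- The empirical measure `(card ι)⁻¹ ∑ i, δ_{y i}` of a finite family of points. The empty family
has no empirical measure; its value, the Dirac mass at an arbitrary point, is a convention. -/
def empMeasure (y : ι → X) : ProbabilityMeasure X :=
  if _ : Nonempty ι then
    ⟨(Fintype.card ι : ℝ≥0∞)⁻¹ • ∑ i, Measure.dirac (y i),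
      isProbabilityMeasure_inv_card_smul_sum_dirac y⟩
  else ⟨Measure.dirac (Classical.arbitrary X), inferInstance⟩

theorem coe_empMeasure [Nonempty ι] (y : ι → X) :
    (empMeasure y : Measure X) = (Fintype.card ι : ℝ≥0∞)⁻¹ • ∑ i, Measure.dirac (y i) :=
  congrArg ProbabilityMeasure.toMeasure (dif_pos ‹Nonempty ι›)

theorem empMeasure_of_isEmpty [IsEmpty ι] (y : ι → X) :
    empMeasure y = ⟨Measure.dirac (Classical.arbitrary X), inferInstance⟩ :=
  dif_neg (not_nonempty_iff.2 ‹_›)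

theorem empMeasure_comp_equiv (e : κ ≃ ι) (y : ι → X) : empMeasure (y ∘ e) = empMeasure y := by
  rcases isEmpty_or_nonempty ι with _ | _
  · have : IsEmpty κ := e.isEmpty
    rw [empMeasure_of_isEmpty, empMeasure_of_isEmpty]
  · have : Nonempty κ := e.nonempty
    apply ProbabilityMeasure.toMeasure_injective
    rw [coe_empMeasure, coe_empMeasure, Fintype.card_congr e]
    exact congrArg _ (Equiv.sum_comp e fun i => Measure.dirac (y i))

theorem map_empMeasure [Nonempty ι] {f : X → Y} (hf : Measurable f) (y : ι → X) :
    (empMeasure y).map hf.aemeasurable = empMeasure (f ∘ y) := by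
  apply ProbabilityMeasure.toMeasure_injective
  rw [ProbabilityMeasure.toMeasure_map, coe_empMeasure, coe_empMeasure, Measure.map_smul,
    Measure.map_finset_sum hf.aemeasurable]
  simp only [Measure.map_dirac' hf, Function.comp_apply]

theorem lintegral_empMeasure [Nonempty ι] (y : ι → X) {f : X → ℝ≥0∞} (hf : Measurable f) :
    ∫⁻ x, f x ∂(empMeasure y : Measure X) = (Fintype.card ι : ℝ≥0∞)⁻¹ * ∑ i, f (y i) := by
  rw [coe_empMeasure, lintegral_smul_measure, lintegral_finsetSum_measure, smul_eq_mul]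
  simp only [lintegral_dirac' _ hf]

theorem empMeasure_apply [Nonempty ι] (y : ι → X) {s : Set X} (hs : MeasurableSet s) :
    (empMeasure y : Measure X) s = (Fintype.card ι : ℝ≥0∞)⁻¹ * ∑ i, s.indicator 1 (y i) := by
  rw [← lintegral_indicator_one hs, lintegral_empMeasure y (measurable_one.indicator hs)]

theorem levyProkhorovEDist_empMeasure_le [PseudoEMetricSpace X]
    [OpensMeasurableSpace X] (x y : ι → X) {δ : ℝ≥0∞} (h : ∀ i, edist (x i) (y i) < δ) :
    levyProkhorovEDist (empMeasure x : Measure X) (empMeasure y : Measure X) ≤ δ := by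
  rcases isEmpty_or_nonempty ι with _ | _
  · rw [Subsingleton.elim x y, levyProkhorovEDist_self]
    exact zero_le
  refine levyProkhorovEDist_le_of_forall_le _ _ δ fun ε B hε hε' hB => le_add_right ?_
  rw [empMeasure_apply x hB, empMeasure_apply y Metric.isOpen_thickening.measurableSet]
  gcongr with i
  refine Set.indicator_apply_le' (fun hi => ?_) fun _ => zero_le
  rw [Set.indicator_of_mem, Pi.one_apply, Pi.one_apply]
  rw [Metric.mem_thickening_iff_exists_edist_lt, ENNReal.ofReal_toReal hε'.ne]
  exact ⟨x i, hi, (edist_comm _ _).trans_lt ((h i).trans hε)⟩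

end EmpMeasure

section Compact

variable {X : Type*} [MetricSpace X] [CompactSpace X] [MeasurableSpace X] [BorelSpace X]

theorem integrable_continuousMap (μ : ProbabilityMeasure X) (f : C(X, ℝ)) :
    Integrable f (μ : Measure X) :=
  .of_bound f.continuous.aestronglyMeasurable ‖f‖ (ae_of_all _ f.norm_coe_le_norm)

theorem tendsto_iff_forall_integral_continuousMap {κ : Type*} {l : Filter κ}
    {μs : κ → ProbabilityMeasure X} {μ : ProbabilityMeasure X} :
    Tendsto μs l (𝓝 μ) ↔ ∀ f : C(X, ℝ),
      Tendsto (fun i => ∫ x, f x ∂(μs i : Measure X)) l (𝓝 (∫ x, f x ∂(μ : Measure X))) := by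
  rw [ProbabilityMeasure.tendsto_iff_forall_integral_tendsto]
  exact ⟨fun h f => h (BoundedContinuousFunction.mkOfCompact f), fun h f => h f.toContinuousMap⟩

theorem lipschitzWith_integral (μ : ProbabilityMeasure X) :
    LipschitzWith 1 fun f : C(X, ℝ) => ∫ x, f x ∂(μ : Measure X) := by
  refine LipschitzWith.of_dist_le_mul fun f g => ?_
  rw [NNReal.coe_one, one_mul, dist_eq_norm,
    ← integral_sub (integrable_continuousMap μ f) (integrable_continuousMap μ g)]
  simpa using norm_integral_le_of_norm_le_const (μ := (μ : Measure X))
    (ae_of_all _ fun x => (dist_eq_norm (f x) (g x)).symm.trans_le (f.dist_apply_le_dist x))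

theorem tendsto_of_forall_denseRange {α κ : Type*} {l : Filter α} {μs : α → ProbabilityMeasure X}
    {μ : ProbabilityMeasure X} {g : κ → C(X, ℝ)} (hg : DenseRange g)
    (h : ∀ k, Tendsto (fun i => ∫ x, g k x ∂(μs i : Measure X)) l
      (𝓝 (∫ x, g k x ∂(μ : Measure X)))) :
    Tendsto μs l (𝓝 μ) := by
  rw [tendsto_iff_forall_integral_continuousMap]
  have hequi : Equicontinuous fun i (f : C(X, ℝ)) => ∫ x, f x ∂(μs i : Measure X) :=
    (LipschitzWith.uniformEquicontinuous _ 1 fun i => lipschitzWith_integral (μs i)).equicontinuous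
  have hclosed := hequi.isClosed_setOfPred_tendsto (l := l) (lipschitzWith_integral μ).continuous
  exact fun f => hclosed.closure_subset_iff.2 (Set.range_subset_iff.2 h) (hg f)

variable [Nonempty X] {ι : Type*} [Fintype ι]

theorem integral_empMeasure [Nonempty ι] (y : ι → X) (f : C(X, ℝ)) :
    ∫ x, f x ∂(empMeasure y : Measure X) = (Fintype.card ι : ℝ)⁻¹ * ∑ i, f (y i) := by
  rw [coe_empMeasure, integral_smul_measure,
    integral_finsetSum_measure fun i _ => integrable_dirac (by simp)]
  simp

theorem continuous_empMeasure : Continuous (empMeasure : (ι → X) → ProbabilityMeasure X) := by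
  rcases isEmpty_or_nonempty ι with _ | _
  · exact continuous_of_discreteTopology
  · rw [ProbabilityMeasure.continuous_iff_forall_continuousMap_continuous_integral]
    intro f
    simp only [integral_empMeasure]
    fun_prop

/-- Varadarajan's theorem. -/
theorem ae_tendsto_empMeasure {Ω : Type*} [MeasurableSpace Ω] {Q : Measure Ω}
    {μ : ProbabilityMeasure X} {Z : ℕ → Ω → X} (hlaw : ∀ i, HasLaw (Z i) (μ : Measure X) Q)
    (hindep : iIndepFun Z Q) :
    ∀ᵐ ω ∂Q, Tendsto (fun n => empMeasure fun i : Fin n => Z i ω) atTop (𝓝 μ) := by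
  have hlln : ∀ f : C(X, ℝ), ∀ᵐ ω ∂Q, Tendsto
      (fun n : ℕ => ∫ x, f x ∂(empMeasure fun i : Fin n => Z i ω : Measure X)) atTop
      (𝓝 (∫ x, f x ∂(μ : Measure X))) := by
    intro f
    have hint : Integrable (fun ω => f (Z 0 ω)) Q :=
      ((hlaw 0).map_eq ▸ integrable_continuousMap μ f).comp_aemeasurable (hlaw 0).aemeasurable
    filter_upwards [strong_law_ae_real (μ := Q) (fun i ω => f (Z i ω)) hint
      (fun i j hij => (hindep.indepFun hij).comp f.continuous.measurable f.continuous.measurable)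
      (fun i => ((hlaw i).identDistrib (hlaw 0)).comp f.continuous.measurable)] with ω hω
    rw [← (hlaw 0).integral_comp f.continuous.aestronglyMeasurable]
    refine hω.congr' ?_
    filter_upwards [eventually_ne_atTop 0] with n hn
    have : NeZero n := ⟨hn⟩
    rw [integral_empMeasure, Finset.sum_range, div_eq_inv_mul, Fintype.card_fin]
  filter_upwards [ae_all_iff.2 fun k => hlln (TopologicalSpace.denseSeq C(X, ℝ) k)] with ω hω
  exact tendsto_of_forall_denseRange (TopologicalSpace.denseRange_denseSeq _) hω

theorem exists_empMeasure_mem {W : Set (ProbabilityMeasure X)} (hW : IsOpen W) (hne : W.Nonempty)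
    {D : Set X} (hD : Dense D) :
    ∃ n ≠ 0, ∃ y : Fin n → X, (∀ i, y i ∈ D) ∧ empMeasure y ∈ W := by
  obtain ⟨μ, hμ⟩ := hne
  obtain ⟨Ω, _, Q, Z, -, hlaw, hindep, _⟩ := exists_iid ℕ (μ : Measure X)
  obtain ⟨ω, hω⟩ := (ae_tendsto_empMeasure hlaw hindep).exists
  obtain ⟨n, hn, hn0⟩ := ((hω.eventually_mem (hW.mem_nhds hμ)).and (eventually_ne_atTop 0)).exists
  obtain ⟨y, hy, hyD⟩ := (dense_pi Set.univ fun (_ : Fin n) _ => hD).inter_open_nonempty _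
    (hW.preimage continuous_empMeasure) ⟨_, hn⟩
  exact ⟨n, hn0, y, fun i => hyD i trivial, hy⟩

theorem exists_empMeasure_nhds {W : Set (ProbabilityMeasure X)} (hW : IsOpen W)
    {μ : ProbabilityMeasure X} (hμ : μ ∈ W) :
    ∃ δ > 0, ∃ V, IsOpen V ∧ μ ∈ V ∧ ∀ (n : ℕ) (x y : Fin n → X), empMeasure x ∈ V →
      (∀ i, dist (y i) (x i) < δ) → empMeasure y ∈ W := by
  let e := LevyProkhorov.probabilityMeasureHomeomorph (Ω := X)
  obtain ⟨ε, hε, hball⟩ := EMetric.isOpen_iff.1 (e.symm.isOpen_preimage.2 hW) (e μ) (by simpa)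
  have hε2 : 0 < ε / 2 := ENNReal.half_pos hε.ne'
  obtain ⟨δ, hδ, hδε⟩ := ENNReal.lt_iff_exists_nnreal_btwn.1 hε2
  refine ⟨δ, by exact_mod_cast hδ, e ⁻¹' Metric.eball (e μ) (ε / 2),
    Metric.isOpen_eball.preimage e.continuous, Metric.mem_eball_self hε2, fun n x y hx hxy => ?_⟩
  have hdist : edist (e (empMeasure y)) (e (empMeasure x)) ≤ δ :=
    levyProkhorovEDist_empMeasure_le y x fun i => edist_lt_coe.2 (hxy i)
  have hmem : e (empMeasure y) ∈ Metric.eball (e μ) ε :=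
    calc edist (e (empMeasure y)) (e μ)
        ≤ edist (e (empMeasure y)) (e (empMeasure x)) + edist (e (empMeasure x)) (e μ) :=
          edist_triangle _ _ _
      _ < ε / 2 + ε / 2 := ENNReal.add_lt_add (hdist.trans_lt hδε) hx
      _ = ε := ENNReal.add_halves ε
  simpa using hball hmem

end Compact

/-! ### The negative half-line and the unit interval -/

section HalfLine

/-- The map `z ↦ 1 / (1 - z)` from the negative half-line onto `(0, 1]`, extended continuously to
`ℂ` through `|re z|`. -/
def toUnit (z : ℂ) : unitInterval :=
  ⟨1 / (1 + |z.re|), by positivity,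
    (div_le_one (by positivity)).2 (le_add_of_nonneg_right (abs_nonneg _))⟩

/-- The inverse `y ↦ 1 - 1 / y` of `toUnit` on the negative half-line; its value at `0` is junk. -/
def ofUnit (y : unitInterval) : ℂ := ((1 - 1 / (y : ℝ) : ℝ) : ℂ)

theorem continuous_toUnit : Continuous toUnit := by
  refine Continuous.subtype_mk (continuous_const.div (by fun_prop) fun z => ?_) _
  positivity

theorem measurable_ofUnit : Measurable ofUnit := by
  unfold ofUnit
  fun_prop

theorem toUnit_ne_zero (z : ℂ) : toUnit z ≠ 0 := by
  have h : (0 : ℝ) < 1 / (1 + |z.re|) := by positivity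
  exact fun h0 => h.ne' (congrArg Subtype.val h0)

theorem coe_toUnit_ofReal {x : ℝ} (hx : x ≤ 0) : (toUnit x : ℝ) = 1 / (1 - x) := by
  simp [toUnit, abs_of_nonpos hx, sub_eq_add_neg]

theorem one_sub_one_div_nonpos {y : unitInterval} (hy : y ≠ 0) : 1 - 1 / (y : ℝ) ≤ 0 :=
  sub_nonpos.2 (one_le_one_div (unitInterval.pos_iff_ne_zero.2 hy) y.2.2)

theorem ofUnit_mem_negLine {y : unitInterval} (hy : y ≠ 0) : ofUnit y ∈ negLine :=
  ⟨_, one_sub_one_div_nonpos hy, rfl⟩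

theorem toUnit_ofUnit {y : unitInterval} (hy : y ≠ 0) : toUnit (ofUnit y) = y := by
  apply Subtype.ext
  rw [ofUnit, coe_toUnit_ofReal (one_sub_one_div_nonpos hy), sub_sub_cancel, one_div_one_div]

theorem ofUnit_toUnit {z : ℂ} (hz : z ∈ negLine) : ofUnit (toUnit z) = z := by
  obtain ⟨x, hx, rfl⟩ := hz
  rw [ofUnit, coe_toUnit_ofReal hx, one_div_one_div, sub_sub_cancel]

theorem continuousAt_ofUnit {y : unitInterval} (hy : y ≠ 0) : ContinuousAt ofUnit y :=
  Complex.continuous_ofReal.continuousAt.comp <| continuousAt_const.sub <|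
    continuousAt_const.div continuous_subtype_val.continuousAt (unitInterval.coe_ne_zero.2 hy)

theorem isOpen_ne_zero_inter_preimage_ofUnit {G : Set ℂ} (hG : IsOpen G) :
    IsOpen ({0}ᶜ ∩ ofUnit ⁻¹' G) :=
  ContinuousOn.isOpen_inter_preimage (fun _ hy => (continuousAt_ofUnit hy).continuousWithinAt)
    isOpen_compl_singleton hG

theorem isClosed_negLine : IsClosed negLine :=
  Complex.isometry_ofReal.isClosedEmbedding.isClosedMap _ isClosed_Iic

theorem isClosed_realLine : IsClosed realLine :=
  Complex.isometry_ofReal.isClosedEmbedding.isClosed_range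

theorem negLine_subset_realLine : negLine ⊆ realLine := Set.image_subset_range _ _

/-- The push-forward of a measure under `toUnit`. -/
def pushUnit (μ : ProbabilityMeasure ℂ) : ProbabilityMeasure unitInterval :=
  μ.map continuous_toUnit.aemeasurable

theorem continuous_pushUnit : Continuous pushUnit :=
  ProbabilityMeasure.continuous_map continuous_toUnit

theorem map_ofUnit_pushUnit {μ : ProbabilityMeasure ℂ} (hμ : μ ∈ probOn negLine) :
    (pushUnit μ).map measurable_ofUnit.aemeasurable = μ := by
  apply ProbabilityMeasure.toMeasure_injective
  rw [pushUnit, ProbabilityMeasure.toMeasure_map, ProbabilityMeasure.toMeasure_map,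
    Measure.map_map measurable_ofUnit continuous_toUnit.measurable]
  refine (Measure.map_congr ?_).trans Measure.map_id
  have hae : ∀ᵐ z ∂(μ : Measure ℂ), z ∈ negLine := hμ
  filter_upwards [hae] with z hz using ofUnit_toUnit hz

theorem injOn_pushUnit : Set.InjOn pushUnit (probOn negLine) :=
  Set.LeftInvOn.injOn (f₁' := fun ν => ν.map measurable_ofUnit.aemeasurable) fun _ hμ =>
    map_ofUnit_pushUnit hμ

theorem exists_pushUnit_eq {ν : ProbabilityMeasure unitInterval}
    (hν : (ν : Measure unitInterval) {0} = 0) : ∃ μ ∈ probOn negLine, pushUnit μ = ν := by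
  refine ⟨ν.map measurable_ofUnit.aemeasurable, ?_, ?_⟩
  · change ((ν.map measurable_ofUnit.aemeasurable : ProbabilityMeasure ℂ) : Measure ℂ) negLineᶜ = 0
    rw [ProbabilityMeasure.toMeasure_map,
      Measure.map_apply measurable_ofUnit isClosed_negLine.measurableSet.compl]
    exact measure_mono_null (fun y hy => not_imp_comm.1 ofUnit_mem_negLine hy) hν
  · apply ProbabilityMeasure.toMeasure_injective
    rw [pushUnit, ProbabilityMeasure.toMeasure_map, ProbabilityMeasure.toMeasure_map,
      Measure.map_map continuous_toUnit.measurable measurable_ofUnit]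
    refine (Measure.map_congr ?_).trans Measure.map_id
    filter_upwards [measure_eq_zero_iff_ae_notMem.1 hν] with y hy using toUnit_ofUnit hy

theorem pushUnit_apply {μ : ProbabilityMeasure ℂ} (hμ : μ ∈ probOn negLine) {G : Set ℂ}
    (hG : IsOpen G) :
    (pushUnit μ : Measure unitInterval) ({0}ᶜ ∩ ofUnit ⁻¹' G) = (μ : Measure ℂ) G := by
  rw [pushUnit, ProbabilityMeasure.toMeasure_map, Measure.map_apply continuous_toUnit.measurable
    (isOpen_ne_zero_inter_preimage_ofUnit hG).measurableSet]
  refine measure_congr ?_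
  have hae : ∀ᵐ z ∂(μ : Measure ℂ), z ∈ negLine := hμ
  filter_upwards [hae] with z hz
  refine propext ((and_iff_right (toUnit_ne_zero z)).trans ?_)
  rw [Set.mem_preimage, ofUnit_toUnit hz]
  rfl

/-- No mass escapes to `-∞`, since a limit in `probOn negLine` gives no mass to `toUnit = 0`. -/
theorem isInducing_pushUnit :
    IsInducing fun μ : probOn negLine => pushUnit (μ : ProbabilityMeasure ℂ) := by
  refine isInducing_iff_nhds.2 fun μ => le_antisymm
    (continuous_pushUnit.comp continuous_subtype_val).continuousAt.tendsto.le_comap ?_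
  rw [← tendsto_id', tendsto_subtype_rng]
  refine tendsto_of_forall_isOpen_le_liminf' fun G hG => ?_
  have h := ProbabilityMeasure.le_liminf_measure_open_of_tendsto
    (tendsto_comap (f := fun μ : probOn negLine => pushUnit (μ : ProbabilityMeasure ℂ))
      (x := 𝓝 (pushUnit (μ : ProbabilityMeasure ℂ)))) (isOpen_ne_zero_inter_preimage_ofUnit hG)
  simp only [pushUnit_apply (Subtype.prop _) hG] at h
  exact h

end HalfLine

/-! ### Empirical measures of zeros -/

section Zeros

variable {ι : Type*} [Fintype ι] [Nonempty ι]

theorem empiricalMeasure_eq_empMeasure {p : ℝ[X]} {x : ι → ℂ}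
    (h : p.aroots ℂ = Finset.univ.val.map x) : empiricalMeasure p = empMeasure x := by
  have hcard : p.natDegree = Fintype.card ι := by
    rw [← IsAlgClosed.card_aroots_eq_natDegree (B := ℂ), h]
    exact Multiset.card_map _ _
  have hdeg : p.natDegree ≠ 0 := hcard ▸ Fintype.card_ne_zero
  have hcoe : (empiricalMeasure p : Measure ℂ) = zeroMeasure p :=
    congrArg ProbabilityMeasure.toMeasure (dif_pos hdeg)
  apply ProbabilityMeasure.toMeasure_injective
  rw [hcoe, coe_empMeasure, zeroMeasure, h, Multiset.card_map, Multiset.map_map]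
  rfl

theorem empiricalMeasure_C_mul_bernoulliPGF {c : ℝ} (hc : c ≠ 0) {y : ι → unitInterval}
    (hy : ∀ i, y i ≠ 0) :
    empiricalMeasure (C c * bernoulliPGF Finset.univ fun i => (y i : ℝ)) =
      empMeasure (ofUnit ∘ y) :=
  empiricalMeasure_eq_empMeasure <|
    aroots_C_mul_bernoulliPGF ℂ hc fun i _ => unitInterval.coe_ne_zero.2 (hy i)

theorem pushUnit_empMeasure_ofUnit {y : ι → unitInterval} (hy : ∀ i, y i ≠ 0) :
    pushUnit (empMeasure (ofUnit ∘ y)) = empMeasure y := by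
  rw [pushUnit, map_empMeasure continuous_toUnit.measurable]
  exact congrArg empMeasure (funext fun i => toUnit_ofUnit (hy i))

theorem empMeasure_mem_probOn_iff {x : ι → ℂ} {S : Set ℂ} (hS : MeasurableSet S) :
    empMeasure x ∈ probOn S ↔ ∀ i, x i ∈ S := by
  change (empMeasure x : Measure ℂ) Sᶜ = 0 ↔ _
  rw [empMeasure_apply x hS.compl]
  simp

theorem splits_of_empiricalMeasure_mem_probOn {p : ℝ[X]} (hp : p.natDegree ≠ 0)
    (h : empiricalMeasure p ∈ probOn realLine) : p.Splits := by
  obtain ⟨x, hx⟩ := exists_univ_val_map_eq (p.aroots ℂ)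
  have : NeZero (p.aroots ℂ).card := ⟨IsAlgClosed.card_aroots_eq_natDegree.trans_ne hp⟩
  rw [empiricalMeasure_eq_empMeasure hx.symm,
    empMeasure_mem_probOn_iff isClosed_realLine.measurableSet] at h
  refine Splits.of_splits_map (algebraMap ℝ ℂ) (IsAlgClosed.splits _) fun z hz => ?_
  obtain ⟨i, -, rfl⟩ := Multiset.mem_map.1 (hx.symm ▸ hz : z ∈ Finset.univ.val.map x)
  exact h i

end Zeros

/-! ### The law of the zeros -/

section Law

theorem prod_diagonal_eq_zero {X : Type*} [MeasurableSpace X] [MeasurableEq X] (μ ν : Measure X)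
    [SFinite ν] [NullSingletonClass ν] : μ.prod ν (Set.diagonal X) = 0 := by
  rw [Measure.measure_prod_null measurableSet_diagonal]
  refine ae_of_all _ fun x => measure_mono_null (fun y hy => ?_) (measure_singleton x)
  exact (Set.mem_diagonal_iff.1 hy).symm

theorem ae_injective_of_iIndepFun {ι Ω X : Type*} [Countable ι] [MeasurableSpace Ω]
    {Q : Measure Ω} [IsFiniteMeasure Q] [MeasurableSpace X] [MeasurableEq X] {μ : Measure X}
    [SFinite μ] [NullSingletonClass μ] {Z : ι → Ω → X} (hlaw : ∀ i, HasLaw (Z i) μ Q)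
    (hindep : iIndepFun Z Q) : ∀ᵐ ω ∂Q, Function.Injective fun i => Z i ω := by
  have hne : ∀ᵐ ω ∂Q, ∀ i j, i ≠ j → Z i ω ≠ Z j ω := by
    refine ae_all_iff.2 fun i => ae_all_iff.2 fun j => eventually_imp_distrib_left.2 fun hij => ?_
    have hpair := (hindep.indepFun hij).hasLaw_prod (hlaw i) (hlaw j)
    refine ae_of_ae_map hpair.aemeasurable (p := fun q => q ∉ Set.diagonal X) ?_
    rw [hpair.map_eq]
    exact measure_eq_zero_iff_ae_notMem.1 (prod_diagonal_eq_zero μ μ)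
  filter_upwards [hne] with ω h i j hij
  exact not_imp_not.1 (h i j) hij

theorem ae_injective_pi {ι X : Type*} [Fintype ι] [MeasurableSpace X] [MeasurableEq X]
    (μ : Measure X) [IsProbabilityMeasure μ] [NullSingletonClass μ] :
    ∀ᵐ y ∂Measure.pi fun _ : ι => μ, Function.Injective y :=
  ae_injective_of_iIndepFun (fun i => (measurePreserving_eval (fun _ => μ) i).hasLaw)
    (iIndepFun_pi (X := fun _ => id) fun _ => aemeasurable_id)

variable {n : ℕ}

theorem measurePreserving_comp_perm {α : Type*} [MeasureSpace α]
    [SigmaFinite (volume : Measure α)] (σ : Equiv.Perm (Fin n)) :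
    MeasurePreserving (fun y : Fin n → α => y ∘ σ) :=
  volume_preserving_arrowCongr' σ.symm (.refl α) (.id _)

theorem abs_det_vandermonde_comp_perm (v : Fin n → ℝ) (σ : Equiv.Perm (Fin n)) :
    |(Matrix.vandermonde (v ∘ σ)).det| = |(Matrix.vandermonde v).det| :=
  Matrix.abs_det_submatrix_equiv_equiv σ (.refl _) (Matrix.vandermonde v)

/-- The increasing configurations in `(0, 1)` with empirical measure in `A`. -/
def unitConfigs (n : ℕ) (A : Set (ProbabilityMeasure unitInterval)) : Set (Fin n → unitInterval) :=
  {y | empMeasure y ∈ A} ∩ {y | StrictMono y ∧ ∀ i, y i ∈ Set.Ioo 0 1}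

/-- The configurations of `unitConfigs n A` as points of `ℝⁿ`. -/
def realConfigs (n : ℕ) (A : Set (ProbabilityMeasure unitInterval)) : Set (Fin n → ℝ) :=
  Pi.map (fun _ => Subtype.val) '' unitConfigs n A

theorem realConfigs_subset_configs (n : ℕ) (A : Set (ProbabilityMeasure unitInterval)) :
    realConfigs n A ⊆ configs n := by
  rintro _ ⟨y, ⟨-, hy, hy01⟩, rfl⟩
  exact ⟨hy, hy01⟩

theorem measurableSet_strictMono (n : ℕ) :
    MeasurableSet {y : Fin n → unitInterval | StrictMono y} := by
  simp only [StrictMono, Set.ofPred_forall]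
  exact .iInter fun i => .iInter fun j => .iInter fun _ =>
    measurableSet_lt (measurable_pi_apply i) (measurable_pi_apply j)

theorem measurableEmbedding_pi_coe_unitInterval (n : ℕ) :
    MeasurableEmbedding (Pi.map fun _ => Subtype.val : (Fin n → unitInterval) → Fin n → ℝ) :=
  (Topology.IsEmbedding.piMap fun _ => .subtypeVal).measurableEmbedding <|
    (isCompact_range (by fun_prop)).isClosed.measurableSet

theorem measurableSet_realConfigs {A : Set (ProbabilityMeasure unitInterval)}
    (hA : MeasurableSet {y : Fin n → unitInterval | empMeasure y ∈ A}) :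
    MeasurableSet (realConfigs n A) := by
  refine (measurableEmbedding_pi_coe_unitInterval n).measurableSet_image' (hA.inter ?_)
  simp only [Set.ofPred_and, Set.ofPred_forall]
  exact (measurableSet_strictMono n).inter <| .iInter fun i =>
    measurable_pi_apply i measurableSet_Ioo

/-- The unnormalized mass of `A` under the empirical measure of the log-gas on `[0, 1]`, whose
density is the absolute value of the Vandermonde determinant. -/
def gasMass (n : ℕ) (A : Set (ProbabilityMeasure unitInterval)) : ℝ≥0∞ :=
  ∫⁻ y in {y : Fin n → unitInterval | empMeasure y ∈ A},
    ENNReal.ofReal |(Matrix.vandermonde fun i => (y i : ℝ)).det|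

theorem measurePreserving_pi_coe_unitInterval (n : ℕ) :
    MeasurePreserving (Pi.map fun _ => Subtype.val : (Fin n → unitInterval) → Fin n → ℝ) volume
      (volume.restrict (Set.univ.pi fun _ => Set.Icc 0 1)) := by
  have h := measurePreserving_pi (fun _ : Fin n => (volume : Measure unitInterval)) _
    fun _ => unitInterval.measurePreserving_coe
  rwa [← Measure.restrict_pi_pi] at h

theorem ae_forall_mem_Ioo (n : ℕ) :
    ∀ᵐ y : Fin n → unitInterval, ∀ i, y i ∈ Set.Ioo 0 1 := by
  refine ae_all_iff.2 fun i => ?_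
  filter_upwards [Measure.ae_eval_ne _ i 0, Measure.ae_eval_ne _ i 1] with y h0 h1
  exact ⟨unitInterval.pos_iff_ne_zero.2 h0, unitInterval.lt_one_iff_ne_one.2 h1⟩

theorem factorial_mul_lintegral_realConfigs {A : Set (ProbabilityMeasure unitInterval)}
    (hA : MeasurableSet {y : Fin n → unitInterval | empMeasure y ∈ A}) :
    n.factorial * ∫⁻ y in realConfigs n A, ENNReal.ofReal |(Matrix.vandermonde y).det| =
      gasMass n A := by
  let V : (Fin n → ℝ) → ℝ≥0∞ := fun y => ENNReal.ofReal |(Matrix.vandermonde y).det|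
  let c : (Fin n → unitInterval) → Fin n → ℝ := Pi.map fun _ => Subtype.val
  let T : Set (Fin n → unitInterval) := {y | empMeasure y ∈ A}
  have hV : Measurable (V ∘ c) :=
    (measurable_abs_det_vandermonde n).comp (measurableEmbedding_pi_coe_unitInterval n).measurable
  have hIcc : c '' unitConfigs n A ⊆ Set.univ.pi fun _ => Set.Icc 0 1 := by
    rintro _ ⟨y, -, rfl⟩ i -
    exact (y i).2
  have hsymm (σ : Equiv.Perm (Fin n)) (y : Fin n → unitInterval) :
      T.indicator (V ∘ c) (y ∘ σ) = T.indicator (V ∘ c) y := by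
    have hT : y ∘ σ ∈ T ↔ y ∈ T := iff_of_eq (congrArg (· ∈ A) (empMeasure_comp_equiv σ y))
    have hVσ : (V ∘ c) (y ∘ σ) = (V ∘ c) y :=
      congrArg ENNReal.ofReal (abs_det_vandermonde_comp_perm (c y) σ)
    by_cases hy : y ∈ T
    · rw [Set.indicator_of_mem (hT.2 hy), Set.indicator_of_mem hy, hVσ]
    · rw [Set.indicator_of_notMem (hT.not.2 hy), Set.indicator_of_notMem hy]
  calc n.factorial * ∫⁻ y in realConfigs n A, V y
      = n.factorial * ∫⁻ y in unitConfigs n A, V (c y) := by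
        rw [(measurePreserving_pi_coe_unitInterval n).setLIntegral_comp_emb
          (measurableEmbedding_pi_coe_unitInterval n), Measure.restrict_restrict_of_subset hIcc]
        rfl
    _ = n.factorial * ∫⁻ y in {y | StrictMono y}, T.indicator (V ∘ c) y := by
        rw [setLIntegral_indicator hA]
        congr 1
        refine setLIntegral_congr (Filter.EventuallyEq.inter ae_eq_rfl ?_)
        filter_upwards [ae_forall_mem_Ioo n] with y hy using propext (and_iff_left hy)
    _ = gasMass n A := by
        exact (lintegral_eq_factorial_mul_strictMono (ae_injective_pi volume)
          (measurableSet_strictMono n) measurePreserving_comp_perm (hV.indicator hA)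
            hsymm).symm.trans (lintegral_indicator hA _)

theorem natDegree_ofFn_succ {x : Fin (n + 1) → ℝ} (hx : x (Fin.last n) ≠ 0) :
    (ofFn (n + 1) x).natDegree = n := by
  refine le_antisymm (Nat.lt_succ_iff.1 (ofFn_natDegree_lt (Nat.le_add_left 1 n) x)) ?_
  refine le_natDegree_of_ne_zero ?_
  rwa [ofFn_coeff_eq_val_of_lt _ n.lt_succ_self]

theorem empiricalMeasure_ofFn_coeffMap [NeZero n] {v : Fin (n + 1) → ℝ} (hv : v 0 ≠ 0)
    {y : Fin n → unitInterval} (hy : ∀ i, y i ≠ 0) (hvy : Fin.tail v = Pi.map (fun _ => (↑)) y) :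
    empiricalMeasure (ofFn (n + 1) (coeffMap n v)) = empMeasure (ofUnit ∘ y) := by
  rw [ofFn_coeffMap, hvy]
  exact empiricalMeasure_C_mul_bernoulliPGF hv hy

theorem exists_coeffMap_eq_of_splits {x : Fin (n + 1) → ℝ} (hx : ∀ k, 0 < x k)
    (hs : (ofFn (n + 1) x).Splits) :
    ∃ v : Fin (n + 1) → ℝ, ∃ y : Fin n → unitInterval, 0 < v 0 ∧ Monotone y ∧
      (∀ i, y i ∈ Set.Ioo 0 1) ∧ Fin.tail v = Pi.map (fun _ => (↑)) y ∧ coeffMap n v = x := by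
  obtain ⟨c, hc, y, hmono, hy, hp⟩ := exists_eq_C_mul_bernoulliPGF
    (natDegree_ofFn_succ (hx _).ne') (fun k hk => by
      rw [ofFn_coeff_eq_val_of_lt _ (Nat.lt_succ_of_le hk)]
      exact hx _) hs
  refine ⟨Fin.cons c y, fun i => ⟨y i, (hy i).1.le, (hy i).2.le⟩, hc, hmono, hy,
    Fin.tail_cons _ _, ?_⟩
  apply injective_ofFn (n + 1)
  rw [ofFn_coeffMap, Fin.cons_zero, Fin.tail_cons, hp]

theorem empiricalMeasure_ofFn_mem_iff [NeZero n] {S : Set ℂ} (hneg : negLine ⊆ S)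
    (hreal : S ⊆ realLine) (A : Set (ProbabilityMeasure unitInterval)) {x : Fin (n + 1) → ℝ}
    (hx : ∀ k, 0 < x k)
    (hinj : x ∉ coeffMap n '' {v | ¬ Function.Injective (Fin.tail v)}) :
    (empiricalMeasure (ofFn (n + 1) x) ∈ probOn S ∧
      pushUnit (empiricalMeasure (ofFn (n + 1) x)) ∈ A) ↔
    x ∈ coeffMap n '' coordDomain (realConfigs n A) := by
  constructor
  · rintro ⟨hS, hA⟩
    have hs := splits_of_empiricalMeasure_mem_probOn
      ((natDegree_ofFn_succ (hx _).ne').trans_ne (NeZero.ne n))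
      (measure_mono_null (Set.compl_subset_compl.2 hreal) hS)
    obtain ⟨v, y, hv, hmono, hy, hvy, rfl⟩ := exists_coeffMap_eq_of_splits hx hs
    have hyinj : Function.Injective y := by
      by_contra h
      refine hinj ⟨v, fun h' => h ?_, rfl⟩
      rw [hvy] at h'
      exact h'.of_comp (f := Subtype.val)
    have hy0 : ∀ i, y i ≠ 0 := fun i => (hy i).1.ne'
    rw [empiricalMeasure_ofFn_coeffMap hv.ne' hy0 hvy, pushUnit_empMeasure_ofUnit hy0] at hA
    exact ⟨v, ⟨hv, y, ⟨hA, hmono.strictMono_of_injective hyinj, hy⟩, hvy.symm⟩, rfl⟩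
  · rintro ⟨v, ⟨hv, y, ⟨hA, -, hy⟩, hvy⟩, rfl⟩
    have hy0 : ∀ i, y i ≠ 0 := fun i => (hy i).1.ne'
    rw [empiricalMeasure_ofFn_coeffMap (Set.mem_Ioi.1 hv).ne' hy0 hvy.symm,
      pushUnit_empMeasure_ofUnit hy0]
    exact ⟨measure_mono_null (Set.compl_subset_compl.2 hneg)
      ((empMeasure_mem_probOn_iff isClosed_negLine.measurableSet).2 fun i =>
        ofUnit_mem_negLine (hy0 i)), hA⟩

end Law

section Events

variable {Ω : Type*} [MeasurableSpace Ω] {P : Measure Ω} [IsProbabilityMeasure P]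
  {r : ℝ} (hr : 0 < r) {ξ : ℕ → Ω → ℝ} (hlaw : ∀ j, HasLaw (ξ j) (expMeasure r) P)
  (hindep : iIndepFun ξ P) {n : ℕ} {S : Set ℂ} (hneg : negLine ⊆ S)
  (hreal : S ⊆ realLine)

theorem randomPoly_eq_ofFn {Ω : Type*} (ξ : ℕ → Ω → ℝ) (n : ℕ) (ω : Ω) :
    randomPoly ξ n ω = ofFn (n + 1) fun k => ξ k ω := by
  rw [randomPoly, Finset.sum_range, ofFn_eq_sum_monomial]
  simp only [C_mul_X_pow_eq_monomial]

include hr hlaw hindep hneg hreal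

theorem event_ae_eq [NeZero n] (A : Set (ProbabilityMeasure unitInterval)) :
    {ω | empL ξ n ω ∈ probOn S ∧ pushUnit (empL ξ n ω) ∈ A} =ᵐ[P]
      (fun ω (k : Fin (n + 1)) => ξ k ω) ⁻¹' (coeffMap n '' coordDomain (realConfigs n A)) := by
  have hpos : ∀ᵐ ω ∂P, ∀ k : Fin (n + 1), 0 < ξ k ω :=
    ae_all_iff.2 fun k => ae_of_ae_map (hlaw k).aemeasurable <|
      (hlaw k).map_eq.symm ▸ ae_pos_expMeasure r
  have hvec := hasLaw_pi_exponential hr hlaw hindep (n + 1)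
  have hnull : ∀ᵐ ω ∂P, (fun k : Fin (n + 1) => ξ k ω) ∉
      coeffMap n '' {v | ¬ Function.Injective (Fin.tail v)} := by
    refine ae_of_ae_map hvec.aemeasurable (p := fun x => x ∉ _) ?_
    rw [hvec.map_eq]
    exact (withDensity_absolutelyContinuous _ _).ae_le <|
      measure_eq_zero_iff_ae_notMem.1 (volume_image_coeffMap_not_injective n)
  filter_upwards [hpos, hnull] with ω hx hinj
  rw [eq_iff_iff]
  change empiricalMeasure (randomPoly ξ n ω) ∈ probOn S ∧
    pushUnit (empiricalMeasure (randomPoly ξ n ω)) ∈ A ↔ _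
  rw [randomPoly_eq_ofFn]
  exact empiricalMeasure_ofFn_mem_iff hneg hreal A hx hinj

theorem measure_event_eq_gasMass [NeZero n] {A : Set (ProbabilityMeasure unitInterval)}
    (hA : MeasurableSet {y : Fin n → unitInterval | empMeasure y ∈ A}) :
    P {ω | empL ξ n ω ∈ probOn S ∧ pushUnit (empL ξ n ω) ∈ A} = gasMass n A := by
  have hB := measurableSet_realConfigs hA
  have hsub := realConfigs_subset_configs n A
  have himage := measurableSet_image_coeffMap hB hsub
  have hvec := hasLaw_pi_exponential hr hlaw hindep (n + 1)
  rw [measure_congr (event_ae_eq hr hlaw hindep hneg hreal A),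
    ← Measure.map_apply_of_aemeasurable hvec.aemeasurable himage, hvec.map_eq,
    withDensity_apply _ himage, lintegral_image_coeffMap hr hB hsub,
    factorial_mul_lintegral_realConfigs hA]

theorem nullMeasurableSet_event [NeZero n] {A : Set (ProbabilityMeasure unitInterval)}
    (hA : MeasurableSet {y : Fin n → unitInterval | empMeasure y ∈ A}) :
    NullMeasurableSet {ω | empL ξ n ω ∈ probOn S ∧ pushUnit (empL ξ n ω) ∈ A} P :=
  ((hasLaw_pi_exponential hr hlaw hindep (n + 1)).aemeasurable.nullMeasurableSet_preimage
    (measurableSet_image_coeffMap (measurableSet_realConfigs hA)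
      (realConfigs_subset_configs n A))).congr
    (event_ae_eq hr hlaw hindep hneg hreal A).symm

end Events

/-! ### Energies -/

section Energy

variable {X : Type*} [MeasurableSpace X]

/-- The energy `∬ k dν dν` of a probability measure `ν` for a nonnegative kernel `k`. -/
def energy (k : X × X → ℝ≥0∞) (ν : ProbabilityMeasure X) : ℝ≥0∞ :=
  ∫⁻ q, k q ∂((ν : Measure X).prod (ν : Measure X))

/-- The off-diagonal energy `∑_{i ≠ j} k (y i, y j)` of a finite configuration. -/
def pairEnergy {X ι : Type*} [Fintype ι] [DecidableEq ι] (k : X × X → ℝ≥0∞) (y : ι → X) : ℝ≥0∞ :=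
  ∑ i, ∑ j ∈ {i}ᶜ, k (y i, y j)

theorem measure_singleton_eq_zero_of_energy_ne_top {k : X × X → ℝ≥0∞} (hk : Measurable k)
    {x : X} (hx : k (x, x) = ∞) {ν : ProbabilityMeasure X} (hν : energy k ν ≠ ∞) :
    (ν : Measure X) {x} = 0 := by
  have hnull : ((ν : Measure X).prod (ν : Measure X)) ({x} ×ˢ {x}) = 0 := by
    refine measure_mono_null ?_ (ae_iff.1 (ae_lt_top hk hν))
    rw [Set.singleton_prod_singleton, Set.singleton_subset_iff]
    simp [hx]
  rwa [Measure.prod_prod, mul_self_eq_zero] at hnull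

theorem energy_eq_iSup_min {k : X × X → ℝ≥0∞} (hk : Measurable k) (ν : ProbabilityMeasure X) :
    energy k ν = ⨆ M : ℕ, energy (fun q => min (k q) M) ν := by
  have hmono : Monotone fun (M : ℕ) q => min (k q) (M : ℝ≥0∞) := fun M N h q =>
    min_le_min le_rfl (Nat.cast_le.2 h)
  unfold energy
  rw [← lintegral_iSup (fun M => hk.min measurable_const) hmono]
  refine lintegral_congr fun q => ?_
  rw [← inf_iSup_eq, ENNReal.iSup_natCast, inf_top_eq]

section Pair

variable {ι κ : Type*} [Fintype ι] [DecidableEq ι] [Fintype κ] [DecidableEq κ]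

theorem pairEnergy_comp_equiv {X : Type*} (k : X × X → ℝ≥0∞) (e : κ ≃ ι) (y : ι → X) :
    pairEnergy k (y ∘ e) = pairEnergy k y :=
  Fintype.sum_equiv e _ _ fun i => Finset.sum_equiv e (by simp) (by simp)

theorem lintegral_pairEnergy_le {k : X × X → ℝ≥0∞} (hk : Measurable k) {Ω : Type*}
    [MeasurableSpace Ω] {Q : Measure Ω} [IsFiniteMeasure Q] {ν : ProbabilityMeasure X}
    {Z : ι → Ω → X} (hlaw : ∀ i, HasLaw (Z i) (ν : Measure X) Q) (hindep : iIndepFun Z Q) :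
    ∫⁻ ω, pairEnergy k (fun i => Z i ω) ∂Q ≤ (Fintype.card ι : ℝ≥0∞) ^ 2 * energy k ν := by
  have hpair (i j : ι) (hij : j ∈ ({i}ᶜ : Finset ι)) :
      ∫⁻ ω, k (Z i ω, Z j ω) ∂Q = energy k ν := by
    have hne : i ≠ j := fun h => by simp [h] at hij
    exact ((hindep.indepFun hne).hasLaw_prod (hlaw i) (hlaw j)).lintegral_comp hk.aemeasurable
  have hm (i j : ι) : AEMeasurable (fun ω => k (Z i ω, Z j ω)) Q :=
    hk.comp_aemeasurable ((hlaw i).aemeasurable.prodMk (hlaw j).aemeasurable)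
  unfold pairEnergy
  rw [lintegral_finsetSum' _ fun i _ => Finset.aemeasurable_fun_sum _ fun j _ => hm i j]
  calc ∑ i, ∫⁻ ω, ∑ j ∈ {i}ᶜ, k (Z i ω, Z j ω) ∂Q
      ≤ ∑ _i : ι, (Fintype.card ι : ℝ≥0∞) * energy k ν := by
        refine Finset.sum_le_sum fun i _ => ?_
        rw [lintegral_finsetSum' _ fun j _ => hm i j, Finset.sum_congr rfl (hpair i),
          Finset.sum_const, nsmul_eq_mul]
        gcongr
        exact Finset.card_le_univ _
    _ = (Fintype.card ι : ℝ≥0∞) ^ 2 * energy k ν := by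
        rw [Finset.sum_const, Finset.card_univ, nsmul_eq_mul, ← mul_assoc, ← sq]

theorem energy_min_empMeasure_le [Nonempty X] [Nonempty ι] {k : X × X → ℝ≥0∞} (hk : Measurable k)
    (M : ℝ≥0∞) (y : ι → X) :
    (Fintype.card ι : ℝ≥0∞) ^ 2 * energy (fun q => min (k q) M) (empMeasure y) ≤
      pairEnergy k y + Fintype.card ι * M := by
  have hm : Measurable fun q => min (k q) M := hk.min measurable_const
  have hcard : (Fintype.card ι : ℝ≥0∞) * (Fintype.card ι : ℝ≥0∞)⁻¹ = 1 :=
    ENNReal.mul_inv_cancel (by simp) (ENNReal.natCast_ne_top _)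
  have henergy : energy (fun q => min (k q) M) (empMeasure y) =
      (Fintype.card ι : ℝ≥0∞)⁻¹ * ((Fintype.card ι : ℝ≥0∞)⁻¹ *
        ∑ i, ∑ j, min (k (y i, y j)) M) := by
    rw [energy, lintegral_prod _ hm.aemeasurable,
      lintegral_empMeasure y hm.lintegral_prod_right']
    refine congrArg _ ((Finset.sum_congr rfl fun i _ => ?_).trans (Finset.mul_sum ..).symm)
    exact lintegral_empMeasure y (hm.comp measurable_prodMk_left)
  have hrow (i : ι) : ∑ j, min (k (y i, y j)) M ≤ ∑ j ∈ {i}ᶜ, k (y i, y j) + M := by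
    rw [← Finset.sum_add_sum_compl {i}ᶜ, compl_compl, Finset.sum_singleton]
    exact add_le_add (Finset.sum_le_sum fun j _ => min_le_left _ _) (min_le_right _ _)
  calc (Fintype.card ι : ℝ≥0∞) ^ 2 * energy (fun q => min (k q) M) (empMeasure y)
      = ∑ i, ∑ j, min (k (y i, y j)) M := by
        rw [henergy, sq, mul_assoc, ← mul_assoc _ _⁻¹, hcard, one_mul, ← mul_assoc, hcard,
          one_mul]
    _ ≤ ∑ i, (∑ j ∈ {i}ᶜ, k (y i, y j) + M) := Finset.sum_le_sum fun i _ => hrow i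
    _ = pairEnergy k y + Fintype.card ι * M := by
        rw [Finset.sum_add_distrib, pairEnergy, Finset.sum_const, Finset.card_univ, nsmul_eq_mul]

end Pair

section Compact

variable {X : Type*} [MetricSpace X] [CompactSpace X] [MeasurableSpace X] [BorelSpace X]
  {k : X × X → ℝ≥0∞}

theorem continuous_energy (hk : Continuous k) (hfin : ∀ q, k q ≠ ∞) :
    Continuous (energy k) := by
  have hcont : Continuous fun q => (k q).toNNReal := continuous_iff_continuousAt.2 fun q =>
    (ENNReal.tendsto_toNNReal (hfin q)).comp hk.continuousAt
  have hdiag : Continuous fun ν : ProbabilityMeasure X => ν.prod ν :=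
    ProbabilityMeasure.continuous_prod.comp (continuous_id.prodMk continuous_id)
  let f : C(X × X, NNReal) := ⟨_, hcont⟩
  exact ((ProbabilityMeasure.continuous_lintegral_continuousMap f).comp hdiag).congr fun ν =>
    lintegral_congr fun q => ENNReal.coe_toNNReal (hfin q)

theorem continuous_energy_min (hk : Continuous k) (M : ℕ) :
    Continuous (energy fun q => min (k q) M) :=
  continuous_energy (hk.min continuous_const) fun _ =>
    ((min_le_right _ _).trans_lt (ENNReal.natCast_lt_top M)).ne

theorem lowerSemicontinuous_energy (hk : Continuous k) : LowerSemicontinuous (energy k) := by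
  simp only [funext (energy_eq_iSup_min hk.measurable)]
  exact lowerSemicontinuous_iSup fun M => (continuous_energy_min hk M).lowerSemicontinuous

theorem exists_lt_energy_min (hk : Continuous k) {F : Set (ProbabilityMeasure X)}
    (hF : IsCompact F) {c : EReal} (hc : ∀ ν ∈ F, c < energy k ν) :
    ∃ M : ℕ, ∀ ν ∈ F, c < energy (fun q => min (k q) M) ν := by
  have hmono (ν : ProbabilityMeasure X) : Monotone fun M : ℕ => energy (fun q => min (k q) M) ν :=
    fun M N h => lintegral_mono fun q => min_le_min le_rfl (Nat.cast_le.2 h)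
  refine hF.elim_directed_cover
    (fun M : ℕ => {ν | c < (energy (fun q => min (k q) M) ν : EReal)})
    (fun M => isOpen_lt continuous_const
      (continuous_coe_ennreal_ereal.comp (continuous_energy_min hk M)))
    (fun ν hν => ?_)
    (directed_of_isDirected_le fun M N h ν hν =>
      lt_of_lt_of_le (Set.mem_ofPred.1 hν) (EReal.coe_ennreal_le_coe_ennreal_iff.2 (hmono ν h)))
  have hlim := tendsto_atTop_iSup (hmono ν)
  rw [← energy_eq_iSup_min hk.measurable] at hlim
  exact Set.mem_iUnion.2 <|
    ((continuous_coe_ennreal_ereal.tendsto _).comp hlim |>.eventually_const_lt (hc ν hν)).exists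

end Compact

end Energy

/-! ### The logarithmic kernel -/

section LogKernel

/-- The logarithmic kernel `-log d(x, y)`, truncated to `0` where `d(x, y) > 1`. -/
def negLogDist {X : Type*} [PseudoEMetricSpace X] (q : X × X) : ℝ≥0∞ :=
  (-ENNReal.log (edist q.1 q.2)).toENNReal

theorem continuous_negLogDist {X : Type*} [PseudoEMetricSpace X] :
    Continuous (negLogDist (X := X)) :=
  EReal.continuous_toENNReal.comp
    (continuous_neg.comp (ENNReal.continuous_log.comp (continuous_fst.edist continuous_snd)))

theorem negLogDist_self {X : Type*} [PseudoEMetricSpace X] (x : X) : negLogDist (x, x) = ∞ := by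
  simp [negLogDist]

theorem exp_neg_negLogDist {X : Type*} [PseudoEMetricSpace X] {x y : X} (h : edist x y ≤ 1) :
    EReal.exp (-(negLogDist (x, y) : EReal)) = edist x y := by
  rw [negLogDist, EReal.coe_toENNReal (EReal.neg_nonneg.2 (ENNReal.log_le_zero_iff.2 h)), neg_neg,
    ENNReal.exp_log]

theorem exp_neg_coe_sum {ι : Type*} (s : Finset ι) (f : ι → ℝ≥0∞) :
    EReal.exp (-((∑ i ∈ s, f i : ℝ≥0∞) : EReal)) = ∏ i ∈ s, EReal.exp (-(f i : EReal)) := by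
  induction s using Finset.cons_induction with
  | empty => simp
  | cons i s hi ih =>
    rw [Finset.sum_cons, Finset.prod_cons, ← ih, ← EReal.exp_add, EReal.coe_ennreal_add,
      EReal.neg_add (by simp) (by simp), sub_eq_add_neg]

theorem edist_unitInterval_le_one (x y : unitInterval) : edist x y ≤ 1 := by
  rw [edist_dist, Subtype.dist_eq, Real.dist_eq, ENNReal.ofReal_le_one, abs_le]
  exact ⟨by linarith [x.2.1, y.2.2], by linarith [x.2.2, y.2.1]⟩

theorem ofReal_abs_det_vandermonde_sq {n : ℕ} (y : Fin n → unitInterval) :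
    ENNReal.ofReal |(Matrix.vandermonde fun i => (y i : ℝ)).det| ^ 2 =
      EReal.exp (-(pairEnergy negLogDist y : EReal)) := by
  have hedist (i j : Fin n) : edist (y i) (y j) = ENNReal.ofReal |(y j : ℝ) - y i| := by
    rw [edist_comm, edist_dist, Subtype.dist_eq, Real.dist_eq]
  simp only [pairEnergy, exp_neg_coe_sum, exp_neg_negLogDist (edist_unitInterval_le_one _ _),
    Matrix.det_vandermonde, Finset.abs_prod]
  rw [ENNReal.ofReal_prod_of_nonneg fun i _ => Finset.prod_nonneg fun j _ => abs_nonneg _]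
  simp only [ENNReal.ofReal_prod_of_nonneg fun _ _ => abs_nonneg _, ← hedist]
  rw [← Finset.prod_prod_Ioi_mul_eq_prod_prod_off_diag fun j i => edist (y i) (y j)]
  simp only [sq, ← Finset.prod_mul_distrib, edist_comm]

theorem abs_det_vandermonde_le_exp_iff {n : ℕ} {y : Fin n → unitInterval} {t : ℝ} :
    |(Matrix.vandermonde fun i => (y i : ℝ)).det| ≤ Real.exp (-(t / 2)) ↔
      (t : EReal) ≤ pairEnergy negLogDist y := by
  rw [← pow_le_pow_iff_left₀ (abs_nonneg _) (Real.exp_pos _).le two_ne_zero, ← Real.exp_nat_mul,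
    ← ENNReal.ofReal_le_ofReal_iff (Real.exp_pos _).le, ENNReal.ofReal_pow (abs_nonneg _),
    ofReal_abs_det_vandermonde_sq, ← EReal.exp_coe, EReal.exp_le_exp_iff, Nat.cast_two, mul_neg,
    mul_div_cancel₀ t two_ne_zero, EReal.coe_neg, EReal.neg_le_neg_iff]

theorem exp_le_abs_det_vandermonde_iff {n : ℕ} {y : Fin n → unitInterval} {t : ℝ} :
    Real.exp (-(t / 2)) ≤ |(Matrix.vandermonde fun i => (y i : ℝ)).det| ↔
      (pairEnergy negLogDist y : EReal) ≤ t := by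
  rw [← pow_le_pow_iff_left₀ (Real.exp_pos _).le (abs_nonneg _) two_ne_zero, ← Real.exp_nat_mul,
    ← ENNReal.ofReal_le_ofReal_iff (by positivity), ENNReal.ofReal_pow (abs_nonneg _),
    ofReal_abs_det_vandermonde_sq, ← EReal.exp_coe, EReal.exp_le_exp_iff, Nat.cast_two, mul_neg,
    mul_div_cancel₀ t two_ne_zero, EReal.coe_neg, EReal.neg_le_neg_iff]

theorem logKernel_eq {z w : ℂ} (hz : z ∈ negLine) (hw : w ∈ negLine) :
    logKernel z w = -ENNReal.log (edist (toUnit z) (toUnit w)) := by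
  obtain ⟨a, ha, rfl⟩ := hz
  obtain ⟨b, hb, rfl⟩ := hw
  have ha1 : 0 < 1 - a := by linarith [Set.mem_Iic.1 ha]
  have hb1 : 0 < 1 - b := by linarith [Set.mem_Iic.1 hb]
  have henorm (x y : ℝ) : ‖(x : ℂ) - y‖ₑ = ENNReal.ofReal |x - y| := by
    rw [← ofReal_norm, ← Complex.ofReal_sub, Complex.norm_real, Real.norm_eq_abs]
  have hedist : edist (toUnit a) (toUnit b) = ENNReal.ofReal (|a - b| / ((1 - a) * (1 - b))) := by
    rw [edist_dist, Subtype.dist_eq, Real.dist_eq, coe_toUnit_ofReal ha, coe_toUnit_ofReal hb,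
      div_sub_div _ _ ha1.ne' hb1.ne', abs_div, abs_of_pos (mul_pos ha1 hb1)]
    ring_nf
  rw [logKernel, hedist, ← Complex.ofReal_one, henorm, henorm, henorm, abs_of_pos ha1,
    abs_of_pos hb1, ENNReal.log_ofReal_of_pos ha1, ENNReal.log_ofReal_of_pos hb1]
  rcases eq_or_ne a b with rfl | hab
  · simp
  · have hab0 : 0 < |a - b| := abs_pos.2 (sub_ne_zero.2 hab)
    rw [ENNReal.log_ofReal_of_pos hab0, ENNReal.log_ofReal_of_pos (by positivity),
      Real.log_div hab0.ne' (by positivity), Real.log_mul ha1.ne' hb1.ne']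
    norm_cast
    ring

theorem eintegral_logKernel {μ : ProbabilityMeasure ℂ} (hμ : μ ∈ probOn negLine) :
    eintegral ((μ : Measure ℂ).prod (μ : Measure ℂ)) (fun q => logKernel q.1 q.2) =
      (energy negLogDist (pushUnit μ) : EReal) := by
  have hae : ∀ᵐ z ∂(μ : Measure ℂ), z ∈ negLine := hμ
  have hker : ∀ᵐ q ∂((μ : Measure ℂ).prod (μ : Measure ℂ)),
      logKernel q.1 q.2 = -ENNReal.log (edist (toUnit q.1) (toUnit q.2)) := by
    filter_upwards [Measure.quasiMeasurePreserving_fst.ae hae,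
      Measure.quasiMeasurePreserving_snd.ae hae] with q hz hw using logKernel_eq hz hw
  have hpos : ∫⁻ q, (logKernel q.1 q.2).toENNReal ∂((μ : Measure ℂ).prod (μ : Measure ℂ)) =
      energy negLogDist (pushUnit μ) := by
    rw [energy, pushUnit, ProbabilityMeasure.toMeasure_map, Measure.map_prod_map _ _
      continuous_toUnit.measurable continuous_toUnit.measurable,
      lintegral_map continuous_negLogDist.measurable
        (continuous_toUnit.measurable.prodMap continuous_toUnit.measurable)]
    exact lintegral_congr_ae (hker.mono fun q hq => congrArg EReal.toENNReal hq)
  have hneg : ∫⁻ q, (-logKernel q.1 q.2).toENNReal ∂((μ : Measure ℂ).prod (μ : Measure ℂ)) = 0 := by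
    refine lintegral_eq_zero_of_ae_eq_zero (hker.mono fun q hq => ?_)
    simp only [hq, neg_neg]
    exact EReal.toENNReal_of_nonpos (ENNReal.log_le_zero_iff.2 (edist_unitInterval_le_one _ _))
  rw [eintegral, hpos, hneg, EReal.coe_ennreal_zero, sub_zero]

end LogKernel

/-! ### Asymptotics of the log-gas -/

section Configurations

variable {X : Type*} [MetricSpace X] [CompactSpace X] [MeasurableSpace X] [BorelSpace X]
  [Nonempty X]

theorem eventually_exists_pairEnergy_le {k : X × X → ℝ≥0∞} (hk : Measurable k)
    {ν : ProbabilityMeasure X} {V : Set (ProbabilityMeasure X)} (hV : IsOpen V) (hν : ν ∈ V)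
    {t : ℝ≥0∞} (ht : energy k ν < t) :
    ∀ᶠ n : ℕ in atTop, ∃ x : Fin n → X, empMeasure x ∈ V ∧ pairEnergy k x ≤ (n : ℝ≥0∞) ^ 2 * t := by
  obtain ⟨Ω, _, Q, Z, hmeas, hlaw, hindep, _⟩ := exists_iid ℕ (ν : Measure X)
  let A (n : ℕ) : Set Ω := {ω | empMeasure (fun i : Fin n => Z i ω) ∈ V}
  have hA (n : ℕ) : MeasurableSet (A n) :=
    (measurable_pi_lambda _ fun i : Fin n => hmeas i)
      (hV.preimage continuous_empMeasure).measurableSet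
  have hQ : Tendsto (fun n => Q (A n)) atTop (𝓝 1) := by
    rw [← measure_univ (μ := Q)]
    refine tendsto_measure_of_ae_tendsto_indicator_of_isFiniteMeasure atTop .univ hA ?_
    filter_upwards [ae_tendsto_empMeasure hlaw hindep] with ω hω
    filter_upwards [hω.eventually_mem (hV.mem_nhds hν)] with n hn using by simpa [A] using hn
  have hlim : Tendsto (fun n => energy k ν / Q (A n)) atTop (𝓝 (energy k ν)) := by
    simpa using ENNReal.Tendsto.const_div hQ (.inr ht.ne_top)
  filter_upwards [hlim.eventually_lt_const ht, hQ.eventually_ne one_ne_zero] with n hn hn0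
  obtain ⟨ω, hω, hle⟩ := exists_le_setLAverage hn0 (measure_ne_top Q _)
    (f := fun ω => pairEnergy k fun i : Fin n => Z i ω) <| by
      unfold pairEnergy
      fun_prop
  refine ⟨_, hω, hle.trans ?_⟩
  rw [setLAverage_eq]
  calc (∫⁻ ω in A n, pairEnergy k fun i : Fin n => Z i ω ∂Q) / Q (A n)
      ≤ (n : ℝ≥0∞) ^ 2 * energy k ν / Q (A n) := by
        gcongr
        refine (setLIntegral_le_lintegral _ _).trans ?_
        simpa using lintegral_pairEnergy_le hk (fun i : Fin n => hlaw i)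
          (hindep.precomp Fin.val_injective)
    _ ≤ (n : ℝ≥0∞) ^ 2 * t := by
        rw [mul_div_assoc]
        gcongr

end Configurations

section LogGas

theorem limsup_log_div_le {m : ℕ → ℝ≥0∞} {a u : ℕ → ℝ} {c : ℝ} (ha : ∀ n, 0 ≤ a n)
    (hm : ∀ᶠ n in atTop, ENNReal.log (m n) ≤ (u n : EReal))
    (hu : Tendsto (fun n => u n / a n) atTop (𝓝 c)) :
    limsup (fun n => ENNReal.log (m n) / (a n : EReal)) atTop ≤ c := by
  rw [← ((continuous_coe_real_ereal.tendsto c).comp hu).limsup_eq]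
  refine limsup_le_limsup (hm.mono fun n hn => ?_)
  exact EReal.div_le_div_right_of_nonneg (EReal.coe_nonneg.2 (ha n)) hn

theorem le_liminf_log_div {m : ℕ → ℝ≥0∞} {a u : ℕ → ℝ} {c : ℝ} (ha : ∀ n, 0 ≤ a n)
    (hm : ∀ᶠ n in atTop, (u n : EReal) ≤ ENNReal.log (m n))
    (hu : Tendsto (fun n => u n / a n) atTop (𝓝 c)) :
    c ≤ liminf (fun n => ENNReal.log (m n) / (a n : EReal)) atTop := by
  rw [← ((continuous_coe_real_ereal.tendsto c).comp hu).liminf_eq]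
  refine liminf_le_liminf (hm.mono fun n hn => ?_)
  exact EReal.div_le_div_right_of_nonneg (EReal.coe_nonneg.2 (ha n)) hn

variable {n : ℕ}

theorem gasMass_mono {A B : Set (ProbabilityMeasure unitInterval)} (h : A ⊆ B) :
    gasMass n A ≤ gasMass n B :=
  lintegral_mono_set fun _ hy => h hy

theorem gasMass_univ_ne_zero (n : ℕ) : gasMass n Set.univ ≠ 0 := by
  simp only [gasMass, Set.mem_univ, Set.ofPred_true, Measure.restrict_univ]
  have hm : Measurable fun y : Fin n → unitInterval =>
      ENNReal.ofReal |(Matrix.vandermonde fun i => (y i : ℝ)).det| :=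
    (measurable_abs_det_vandermonde n).comp (measurableEmbedding_pi_coe_unitInterval n).measurable
  rw [Ne, lintegral_eq_zero_iff hm]
  intro hzero
  obtain ⟨y, hy, hinj⟩ := (hzero.and (ae_injective_pi volume)).exists
  have hdet : (Matrix.vandermonde fun i => (y i : ℝ)).det ≠ 0 :=
    Matrix.det_vandermonde_ne_zero_iff.2 (Subtype.val_injective.comp hinj)
  exact (ENNReal.ofReal_pos.2 (abs_pos.2 hdet)).ne' hy

theorem log_gasMass_le {A : Set (ProbabilityMeasure unitInterval)} {t : ℝ}
    (h : ∀ y : Fin n → unitInterval, empMeasure y ∈ A → (t : EReal) ≤ pairEnergy negLogDist y) :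
    ENNReal.log (gasMass n A) ≤ ((-(t / 2) : ℝ) : EReal) := by
  rw [← Real.log_exp (-(t / 2)), ← ENNReal.log_ofReal_of_pos (Real.exp_pos _),
    ENNReal.log_le_log_iff]
  calc gasMass n A ≤ ∫⁻ _ in {y : Fin n → unitInterval | empMeasure y ∈ A},
          ENNReal.ofReal (Real.exp (-(t / 2))) :=
        setLIntegral_mono measurable_const fun y hy =>
          ENNReal.ofReal_le_ofReal (abs_det_vandermonde_le_exp_iff.2 (h y hy))
    _ ≤ ENNReal.ofReal (Real.exp (-(t / 2))) := by
        rw [setLIntegral_const]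
        exact mul_le_of_le_one_right' prob_le_one

theorem gasMass_univ_ne_top (n : ℕ) : gasMass n Set.univ ≠ ∞ := by
  have h : ENNReal.log (gasMass n Set.univ) ≤ ((-(0 / 2) : ℝ) : EReal) :=
    log_gasMass_le fun y _ => EReal.coe_ennreal_nonneg _
  intro htop
  simp [htop] at h

theorem coe_sub_le_pairEnergy [NeZero n] {X : Type*} [MeasurableSpace X] [Nonempty X]
    {k : X × X → ℝ≥0∞} (hk : Measurable k) {c : ℝ} {M : ℕ} {y : Fin n → X}
    (hc : (c : EReal) ≤ energy (fun q => min (k q) M) (empMeasure y)) :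
    ((n ^ 2 * c - n * M : ℝ) : EReal) ≤ pairEnergy k y := by
  have hsq : ((n ^ 2 : ℝ≥0∞) : EReal) = ((n ^ 2 : ℝ) : EReal) := by norm_cast
  have hmul : ((n * M : ℝ≥0∞) : EReal) = ((n * M : ℝ) : EReal) := by norm_cast
  have h := EReal.coe_ennreal_le_coe_ennreal_iff.2 (energy_min_empMeasure_le hk M y)
  rw [Fintype.card_fin, EReal.coe_ennreal_mul, EReal.coe_ennreal_add, hsq, hmul] at h
  rw [EReal.coe_sub, EReal.coe_mul]
  exact EReal.sub_le_of_le_add <|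
    (mul_le_mul_of_nonneg_left hc (EReal.coe_nonneg.2 (sq_nonneg _))).trans h

theorem limsup_log_gasMass_le {F : Set (ProbabilityMeasure unitInterval)} (hF : IsClosed F)
    {m : EReal} (hm : ∀ ν ∈ F, m ≤ (energy negLogDist ν : EReal) / 2) :
    limsup (fun n : ℕ => ENNReal.log (gasMass n F) / (((n : ℝ) ^ 2 : ℝ) : EReal)) atTop ≤ -m := by
  rw [EReal.le_neg, ← EReal.ge_of_forall_gt_iff_ge]
  intro z hz
  rw [EReal.le_neg, ← EReal.coe_neg]
  have hk : Continuous (negLogDist (X := unitInterval)) := continuous_negLogDist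
  obtain ⟨M, hM⟩ := exists_lt_energy_min hk hF.isCompact (c := (z * 2 : ℝ)) fun ν hν => by
    rw [EReal.coe_mul]
    exact (EReal.lt_div_iff (by norm_num) (by norm_num)).1 (hz.trans_le (hm ν hν))
  have hlim : Tendsto (fun n : ℕ => -z + M / 2 * (n : ℝ)⁻¹) atTop (𝓝 (-z)) := by
    simpa using (tendsto_inv_atTop_nhds_zero_nat (𝕜 := ℝ)).const_mul (M / 2 : ℝ) |>.const_add (-z)
  refine limsup_log_div_le (u := fun n => -((n ^ 2 * (z * 2) - n * M) / 2)) (fun n => by positivity)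
    ?_ (hlim.congr' ?_)
  · filter_upwards [eventually_ne_atTop 0] with n hn
    have : NeZero n := ⟨hn⟩
    refine log_gasMass_le fun y hy => ?_
    exact coe_sub_le_pairEnergy hk.measurable (hM _ hy).le
  · filter_upwards [eventually_ne_atTop 0] with n hn
    field_simp
    ring

/-- A box of configurations around the increasing configuration `x`, in which points are kept
apart by contracting `x` towards the grid of the `i / n`. -/
def spreadBox (x : Fin n → unitInterval) : Set (Fin n → unitInterval) :=
  Set.univ.pi fun i =>
    (↑) ⁻¹' Set.Icc ((n * (x i : ℝ) + i / n) / (n + 1)) ((n * (x i : ℝ) + (i + 1) / n) / (n + 1))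

theorem volume_preimage_coe_Icc {a b : ℝ} (ha : 0 ≤ a) (hb : b ≤ 1) :
    volume ((↑) ⁻¹' Set.Icc a b : Set unitInterval) = ENNReal.ofReal (b - a) := by
  rw [unitInterval.measurePreserving_coe.measure_preimage measurableSet_Icc.nullMeasurableSet,
    Measure.restrict_apply measurableSet_Icc, Set.inter_eq_left.2 (Set.Icc_subset_Icc ha hb),
    Real.volume_Icc]

theorem volume_spreadBox (x : Fin n → unitInterval) :
    volume (spreadBox x) = ENNReal.ofReal ((n * (n + 1) : ℝ)⁻¹ ^ n) := by
  have hside (i : Fin n) : volume ((↑) ⁻¹' Set.Icc ((n * (x i : ℝ) + i / n) / (n + 1))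
      ((n * (x i : ℝ) + (i + 1) / n) / (n + 1)) : Set unitInterval) =
      ENNReal.ofReal (n * (n + 1) : ℝ)⁻¹ := by
    have hn : (0 : ℝ) < n := Nat.cast_pos.2 i.pos
    have hi : ((i : ℝ) + 1) / n ≤ 1 := by
      rw [div_le_one hn]
      exact_mod_cast i.2
    rw [volume_preimage_coe_Icc]
    · congr 1
      field_simp
      ring
    · have := (x i).2.1
      positivity
    · rw [div_le_one (by positivity)]
      nlinarith [(x i).2.2]
  rw [spreadBox, volume_pi_pi, Finset.prod_congr rfl fun i _ => hside i, Finset.prod_const,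
    Finset.card_univ, Fintype.card_fin, ENNReal.ofReal_pow (by positivity)]

theorem dist_le_of_mem_spreadBox {x y : Fin n → unitInterval} (hy : y ∈ spreadBox x) (i : Fin n) :
    dist (y i) (x i) ≤ 1 / (n + 1) := by
  have hn : (0 : ℝ) < n := Nat.cast_pos.2 i.pos
  have hi0 : 0 ≤ (i : ℝ) / n := by positivity
  have hi1 : ((i : ℝ) + 1) / n ≤ 1 := by
    rw [div_le_one hn]
    exact_mod_cast i.2
  obtain ⟨hlow, hupp⟩ := hy i trivial
  rw [div_le_iff₀ (by positivity)] at hlow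
  rw [le_div_iff₀ (by positivity)] at hupp
  rw [Subtype.dist_eq, Real.dist_eq, le_div_iff₀ (by positivity), ← abs_of_pos (a := (n : ℝ) + 1)
    (by positivity), ← abs_mul, abs_le]
  constructor <;> nlinarith [(x i).2.1, (x i).2.2]

theorem sub_le_sub_of_mem_spreadBox {x y : Fin n → unitInterval} (hy : y ∈ spreadBox x)
    {i j : Fin n} (hij : i < j) : (n / (n + 1) : ℝ) * (x j - x i) ≤ y j - y i := by
  have hgrid : ((i : ℝ) + 1) / n ≤ j / n := by
    gcongr
    exact_mod_cast hij
  calc (n / (n + 1) : ℝ) * (x j - x i)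
      = (n * x j + (i + 1) / n) / (n + 1) - (n * x i + (i + 1) / n) / (n + 1) := by ring
    _ ≤ (n * x j + j / n) / (n + 1) - (n * x i + (i + 1) / n) / (n + 1) := by gcongr
    _ ≤ y j - y i := sub_le_sub (hy j trivial).1 (hy i trivial).2

theorem pow_mul_abs_det_vandermonde_le {c : ℝ} (hc0 : 0 ≤ c) (hc1 : c ≤ 1) {x y : Fin n → ℝ}
    (h : ∀ i j, i < j → c * |x j - x i| ≤ |y j - y i|) :
    c ^ (n ^ 2) * |(Matrix.vandermonde x).det| ≤ |(Matrix.vandermonde y).det| := by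
  simp only [Matrix.det_vandermonde, Finset.abs_prod]
  have hcard : ∑ i : Fin n, (Finset.Ioi i).card ≤ n ^ 2 :=
    calc ∑ i : Fin n, (Finset.Ioi i).card ≤ ∑ _i : Fin n, n :=
          Finset.sum_le_sum fun i _ => (Finset.card_le_univ _).trans_eq (Fintype.card_fin n)
      _ = n ^ 2 := by simp [sq]
  calc c ^ (n ^ 2) * ∏ i, ∏ j ∈ Finset.Ioi i, |x j - x i|
      ≤ c ^ (∑ i : Fin n, (Finset.Ioi i).card) * ∏ i, ∏ j ∈ Finset.Ioi i, |x j - x i| :=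
        mul_le_mul_of_nonneg_right (pow_le_pow_of_le_one hc0 hc1 hcard) <|
          Finset.prod_nonneg fun i _ => Finset.prod_nonneg fun j _ => abs_nonneg _
    _ = ∏ i, ∏ j ∈ Finset.Ioi i, c * |x j - x i| := by
        simp only [Finset.prod_mul_distrib, Finset.prod_const, Finset.prod_pow_eq_pow_sum]
    _ ≤ ∏ i, ∏ j ∈ Finset.Ioi i, |y j - y i| :=
        Finset.prod_le_prod (fun i _ => Finset.prod_nonneg fun j _ => by positivity) fun i _ =>
          Finset.prod_le_prod (fun j _ => by positivity) fun j hj => h i j (Finset.mem_Ioi.1 hj)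

theorem le_gasMass {W : Set (ProbabilityMeasure unitInterval)} {x : Fin n → unitInterval}
    (hx : Monotone x) (hW : ∀ y ∈ spreadBox x, empMeasure y ∈ W) :
    ENNReal.ofReal ((n / (n + 1) : ℝ) ^ (n ^ 2) * |(Matrix.vandermonde fun i => (x i : ℝ)).det| *
      (n * (n + 1) : ℝ)⁻¹ ^ n) ≤ gasMass n W := by
  have hV (y) (hy : y ∈ spreadBox x) :
      (n / (n + 1) : ℝ) ^ (n ^ 2) * |(Matrix.vandermonde fun i => (x i : ℝ)).det| ≤
        |(Matrix.vandermonde fun i => (y i : ℝ)).det| := by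
    refine pow_mul_abs_det_vandermonde_le (by positivity)
      (div_le_one_of_le₀ (by simp) (by positivity)) fun i j hij => ?_
    rw [abs_of_nonneg (sub_nonneg.2 (Subtype.coe_le_coe.2 (hx hij.le)))]
    exact (sub_le_sub_of_mem_spreadBox hy hij).trans (le_abs_self _)
  rw [ENNReal.ofReal_mul (by positivity), ← volume_spreadBox x, ← setLIntegral_const]
  have hbox : MeasurableSet (spreadBox x) :=
    MeasurableSet.univ_pi fun i => measurable_subtype_coe measurableSet_Icc
  exact (setLIntegral_mono' hbox fun y hy => ENNReal.ofReal_le_ofReal (hV y hy)).trans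
    (lintegral_mono_set hW)

theorem exp_neg_le_div_pow (n : ℕ) : Real.exp (-n) ≤ (n / (n + 1) : ℝ) ^ (n ^ 2) := by
  rcases eq_or_ne n 0 with rfl | hn
  · simp
  have hexp : Real.exp (-(1 / n)) ≤ n / (n + 1) := by
    rw [Real.exp_neg, inv_le_comm₀ (Real.exp_pos _) (by positivity), inv_div, add_div,
      div_self (by positivity), add_comm]
    exact Real.add_one_le_exp _
  calc Real.exp (-n) = Real.exp (-(1 / n)) ^ (n ^ 2) := by
        rw [← Real.exp_nat_mul]
        congr 1
        push_cast
        field_simp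
    _ ≤ (n / (n + 1) : ℝ) ^ (n ^ 2) := by gcongr

theorem le_log_gasMass {W : Set (ProbabilityMeasure unitInterval)} {t : ℝ}
    {x : Fin n → unitInterval} (hx : Monotone x) (ht : (pairEnergy negLogDist x : EReal) ≤ t)
    (hW : ∀ y : Fin n → unitInterval, (∀ i, dist (y i) (x i) ≤ 1 / (n + 1)) → empMeasure y ∈ W) :
    ((-(t / 2) - n - n * Real.log (n * (n + 1)) : ℝ) : EReal) ≤ ENNReal.log (gasMass n W) := by
  have hpow : Real.exp (-(n * Real.log (n * (n + 1)))) = (n * (n + 1) : ℝ)⁻¹ ^ n := by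
    rcases eq_or_ne n 0 with rfl | hn
    · simp
    · rw [Real.exp_neg, Real.exp_nat_mul, Real.exp_log (by positivity), inv_pow]
  rw [← Real.log_exp (-(t / 2) - n - _), ← ENNReal.log_ofReal_of_pos (Real.exp_pos _),
    ENNReal.log_le_log_iff]
  refine le_trans (ENNReal.ofReal_le_ofReal ?_)
    (le_gasMass hx fun y hy => hW y (dist_le_of_mem_spreadBox hy))
  calc Real.exp (-(t / 2) - n - n * Real.log (n * (n + 1)))
      = Real.exp (-n) * Real.exp (-(t / 2)) * Real.exp (-(n * Real.log (n * (n + 1)))) := by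
        rw [← Real.exp_add, ← Real.exp_add]
        ring_nf
    _ ≤ _ := by
        rw [hpow]
        gcongr
        · exact exp_neg_le_div_pow n
        · exact exp_le_abs_det_vandermonde_iff.2 ht

theorem tendsto_sub_log_mul_div_sq (c : ℝ) :
    Tendsto (fun n : ℕ => (-(n ^ 2 * c) - n - n * Real.log (n * (n + 1))) / (n : ℝ) ^ 2) atTop
      (𝓝 (-c)) := by
  have hlog : Tendsto (fun n : ℕ => Real.log n / n) atTop (𝓝 0) :=
    Real.isLittleO_log_id_atTop.tendsto_div_nhds_zero.comp tendsto_natCast_atTop_atTop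
  have hlog_succ : Tendsto (fun n : ℕ => Real.log (n + 1) / n) atTop (𝓝 0) := by
    have h := (hlog.comp (tendsto_add_atTop_nat 1)).div
      (tendsto_natCast_div_add_atTop (1 : ℝ)) one_ne_zero
    rw [zero_div] at h
    refine h.congr fun n => ?_
    simp only [Pi.div_apply, Function.comp_apply, Nat.cast_add, Nat.cast_one]
    rw [div_div_div_cancel_right₀ (by positivity)]
  have h := ((tendsto_inv_atTop_nhds_zero_nat (𝕜 := ℝ)).add (hlog.add hlog_succ)).const_sub (-c)
  rw [add_zero, add_zero, sub_zero] at h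
  refine h.congr' ?_
  filter_upwards [eventually_ne_atTop 0] with n hn
  rw [Real.log_mul (by positivity) (by positivity)]
  field_simp
  ring

theorem le_liminf_log_gasMass {O : Set (ProbabilityMeasure unitInterval)} (hO : IsOpen O)
    {ν : ProbabilityMeasure unitInterval} (hν : ν ∈ O) :
    -((energy negLogDist ν : EReal) / 2) ≤
      liminf (fun n : ℕ => ENNReal.log (gasMass n O) / (((n : ℝ) ^ 2 : ℝ) : EReal)) atTop := by
  have hk : Measurable (negLogDist (X := unitInterval)) := continuous_negLogDist.measurable
  rw [EReal.neg_le, ← EReal.le_of_forall_lt_iff_le]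
  intro z hz
  rw [EReal.neg_le, ← EReal.coe_neg]
  have hzE : (energy negLogDist ν : EReal) < (2 * z : ℝ) := by
    rw [mul_comm, EReal.coe_mul]
    exact (EReal.div_lt_iff (by norm_num) (by norm_num)).1 hz
  have hz0 : 0 ≤ 2 * z := EReal.coe_nonneg.1 ((EReal.coe_ennreal_nonneg _).trans hzE.le)
  have hzcoe : (ENNReal.ofReal (2 * z) : EReal) = (2 * z : ℝ) := by
    rw [EReal.coe_ennreal_ofReal, max_eq_left hz0]
  have hz2 : energy negLogDist ν < ENNReal.ofReal (2 * z) := by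
    rwa [← EReal.coe_ennreal_lt_coe_ennreal_iff, hzcoe]
  obtain ⟨δ, hδ, V, hV, hνV, hVO⟩ := exists_empMeasure_nhds hO hν
  refine le_liminf_log_div (fun n => by positivity) ?_ (tendsto_sub_log_mul_div_sq z)
  filter_upwards [eventually_exists_pairEnergy_le hk hV hνV hz2,
    tendsto_one_div_add_atTop_nhds_zero_nat.eventually_lt_const hδ] with n ⟨x, hxV, hxz⟩ hn
  have hmono : Monotone (x ∘ Tuple.sort x) := Tuple.monotone_sort x
  have ht : (pairEnergy negLogDist (x ∘ Tuple.sort x) : EReal) ≤ (n ^ 2 * (2 * z) : ℝ) := by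
    have hsq : ((n ^ 2 : ℝ≥0∞) : EReal) = ((n ^ 2 : ℝ) : EReal) := by norm_cast
    have h := EReal.coe_ennreal_le_coe_ennreal_iff.2 hxz
    rwa [EReal.coe_ennreal_mul, hsq, hzcoe, ← EReal.coe_mul,
      ← pairEnergy_comp_equiv _ (Tuple.sort x)] at h
  convert le_log_gasMass hmono ht fun y hy => hVO n _ y (by rwa [empMeasure_comp_equiv])
    fun i => (hy i).trans_lt hn using 2
  ring

end LogGas

/-! ### Uniqueness of the energy minimiser -/

section Feature

variable {X A : Type*} [MeasurableSpace X] [MeasurableSpace A] {k : X × X → ℝ≥0∞}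
  {M : Measure A} [SFinite M] {S : A → Set X}

theorem energy_eq_lintegral_sq
    (hS : MeasurableSet {q : A × X | q.2 ∈ S q.1})
    (hk : ∀ x y, k (x, y) = ∫⁻ a, (S a).indicator 1 x * (S a).indicator 1 y ∂M)
    (ν : ProbabilityMeasure X) : energy k ν = ∫⁻ a, (ν : Measure X) (S a) ^ 2 ∂M := by
  have hind : Measurable fun q : A × X => (S q.1).indicator (1 : X → ℝ≥0∞) q.2 :=
    (measurable_const (a := (1 : ℝ≥0∞))).indicator hS
  have hSa (a : A) : MeasurableSet (S a) := measurable_prodMk_left hS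
  have hprod : Measurable fun p : (X × X) × A =>
      (S p.2).indicator (1 : X → ℝ≥0∞) p.1.1 * (S p.2).indicator 1 p.1.2 :=
    (hind.comp (measurable_snd.prodMk (measurable_fst.comp measurable_fst))).mul
      (hind.comp (measurable_snd.prodMk (measurable_snd.comp measurable_fst)))
  calc energy k ν
      = ∫⁻ q, ∫⁻ a, (S a).indicator 1 q.1 * (S a).indicator 1 q.2 ∂M
          ∂((ν : Measure X).prod (ν : Measure X)) := lintegral_congr fun q => hk q.1 q.2
    _ = ∫⁻ a, ∫⁻ q, (S a).indicator 1 q.1 * (S a).indicator 1 q.2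
          ∂((ν : Measure X).prod (ν : Measure X)) ∂M := lintegral_lintegral_swap hprod.aemeasurable
    _ = ∫⁻ a, (ν : Measure X) (S a) ^ 2 ∂M := lintegral_congr fun a => by
      have hm : AEMeasurable ((S a).indicator (1 : X → ℝ≥0∞)) (ν : Measure X) :=
        (measurable_one.indicator (hSa a)).aemeasurable
      rw [lintegral_prod_mul hm hm, lintegral_indicator_one (hSa a), sq]

theorem exists_eq_half_add (ν ρ : ProbabilityMeasure X) :
    ∃ π : ProbabilityMeasure X, ∀ s, π s = (ν s + ρ s) / 2 := by
  let π : ProbabilityMeasure X := ⟨(2 : ℝ≥0∞)⁻¹ • ((ν : Measure X) + (ρ : Measure X)),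
    ⟨by simp [← two_mul, ENNReal.mul_inv_cancel]⟩⟩
  refine ⟨π, fun s => ?_⟩
  rw [← ENNReal.coe_inj, ProbabilityMeasure.ennreal_coeFn_eq_coeFn_toMeasure]
  simp [π, ENNReal.div_eq_inv_mul, mul_add]

theorem ae_eq_of_lintegral_sq_le {A : Type*} [MeasurableSpace A] {M : Measure A} {f g : A → NNReal}
    (hf : Measurable f) (hg : Measurable g) (hfin : ∫⁻ a, (f a ^ 2 : NNReal) ∂M ≠ ∞)
    (hfg : ∫⁻ a, (f a ^ 2 : NNReal) ∂M = ∫⁻ a, (g a ^ 2 : NNReal) ∂M)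
    (hmid : ∫⁻ a, (f a ^ 2 : NNReal) ∂M ≤ ∫⁻ a, (((f a + g a) / 2) ^ 2 : NNReal) ∂M) :
    f =ᵐ[M] g := by
  have hmean : ∫⁻ a, ((f a ^ 2 + g a ^ 2) / 2 : NNReal) ∂M = ∫⁻ a, (f a ^ 2 : NNReal) ∂M := by
    have hcoe (a : A) : (((f a ^ 2 + g a ^ 2) / 2 : NNReal) : ℝ≥0∞) =
        2⁻¹ * ((f a ^ 2 : NNReal) + (g a ^ 2 : NNReal)) := by
      simp [ENNReal.div_eq_inv_mul]
    rw [lintegral_congr hcoe, lintegral_const_mul _ (by fun_prop),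
      lintegral_add_left (by fun_prop), ← hfg, ← two_mul, ← mul_assoc,
      ENNReal.inv_mul_cancel two_ne_zero ENNReal.ofNat_ne_top, one_mul]
  have hle (a : A) : ((((f a + g a) / 2) ^ 2 : NNReal) : ℝ≥0∞) ≤
      ((f a ^ 2 + g a ^ 2) / 2 : NNReal) := by
    rw [ENNReal.coe_le_coe, ← NNReal.coe_le_coe]
    push_cast
    nlinarith [sq_nonneg ((f a : ℝ) - g a)]
  have hae := ae_eq_of_ae_le_of_lintegral_le (.of_forall hle)
    (ne_top_of_le_ne_top (hmean ▸ hfin) (lintegral_mono hle)) (by fun_prop) (hmean.trans_le hmid)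
  filter_upwards [hae] with a ha
  rw [ENNReal.coe_inj, ← NNReal.coe_inj] at ha
  push_cast at ha
  exact NNReal.coe_inj.1 (by nlinarith [sq_nonneg ((f a : ℝ) - g a)])

theorem ae_measure_eq_of_forall_energy_le
    (hS : MeasurableSet {q : A × X | q.2 ∈ S q.1})
    (hk : ∀ x y, k (x, y) = ∫⁻ a, (S a).indicator 1 x * (S a).indicator 1 y ∂M)
    {ν ρ : ProbabilityMeasure X} (hν : energy k ν ≠ ∞) (hνmin : ∀ π, energy k ν ≤ energy k π)
    (hρmin : ∀ π, energy k ρ ≤ energy k π) : ∀ᵐ a ∂M, ν (S a) = ρ (S a) := by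
  have hE (κ : ProbabilityMeasure X) : energy k κ = ∫⁻ a, (κ (S a) ^ 2 : NNReal) ∂M := by
    simp [energy_eq_lintegral_sq hS hk]
  have hm (κ : ProbabilityMeasure X) : Measurable fun a => κ (S a) :=
    (measurable_measure_prodMk_left (ν := (κ : Measure X)) hS).ennreal_toNNReal
  obtain ⟨π, hπ⟩ := exists_eq_half_add ν ρ
  refine ae_eq_of_lintegral_sq_le (hm ν) (hm ρ) (hE ν ▸ hν) ?_ ?_
  · rw [← hE, ← hE]
    exact (hνmin ρ).antisymm (hρmin ν)
  · simpa only [hE, hπ] using hνmin π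

end Feature

/-- The trace on `[0, 1]` of the interval `(z, z + e⁻ᵗ]`, for `a = (t, z)`. -/
def window (a : ℝ × ℝ) : Set unitInterval :=
  {x | (x : ℝ) ∈ Set.Ioc a.2 (a.2 + Real.exp (-a.1))}

/-- The weight with which the windows `a = (t, z)` have to be superposed to produce the logarithmic
kernel: `eᵗ dt dz` on `t > 0`, together with `dz` on the line `t = 0`. -/
def windowMeasure : Measure (ℝ × ℝ) :=
  ((volume.restrict (Set.Ioi (0 : ℝ)) + Measure.dirac 0).withDensity
    fun t : ℝ => ENNReal.ofReal (Real.exp t)).prod volume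

instance : SFinite windowMeasure := by
  unfold windowMeasure
  infer_instance

theorem measurableSet_window : MeasurableSet {q : (ℝ × ℝ) × unitInterval | q.2 ∈ window q.1} := by
  have hx : Measurable fun q : (ℝ × ℝ) × unitInterval => (q.2 : ℝ) := by fun_prop
  exact (measurableSet_lt (by fun_prop) hx).inter (measurableSet_le hx (by fun_prop))

theorem lintegral_windowMeasure {f : ℝ × ℝ → ℝ≥0∞} (hf : Measurable f) :
    ∫⁻ a, f a ∂windowMeasure =
      (∫⁻ t in Set.Ioi 0, ENNReal.ofReal (Real.exp t) * ∫⁻ z, f (t, z)) + ∫⁻ z, f (0, z) := by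
  have hexp : Measurable fun t : ℝ => ENNReal.ofReal (Real.exp t) := by fun_prop
  have hint : Measurable fun t : ℝ => ∫⁻ z, f (t, z) := hf.lintegral_prod_right'
  rw [windowMeasure, lintegral_prod _ hf.aemeasurable,
    lintegral_withDensity_eq_lintegral_mul _ hexp hint, lintegral_add_measure,
    lintegral_dirac' _ (hexp.mul hint)]
  simp

theorem lintegral_window_mul_window (t : ℝ) (x y : unitInterval) :
    ∫⁻ z, (window (t, z)).indicator 1 x * (window (t, z)).indicator 1 y =
      ENNReal.ofReal (Real.exp (-t) - |(x : ℝ) - y|) := by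
  have hmem (z : ℝ) : (window (t, z)).indicator 1 x * (window (t, z)).indicator 1 y =
      (Set.Ico (max (x : ℝ) y - Real.exp (-t)) (min (x : ℝ) y)).indicator (1 : ℝ → ℝ≥0∞) z := by
    have : z ∈ Set.Ico (max (x : ℝ) y - Real.exp (-t)) (min (x : ℝ) y) ↔
        x ∈ window (t, z) ∧ y ∈ window (t, z) := by
      simp only [window, Set.mem_Ico, Set.mem_Ioc, Set.mem_ofPred_eq, sub_le_iff_le_add, max_le_iff,
        lt_min_iff]
      tauto
    by_cases hx : x ∈ window (t, z) <;> by_cases hy : y ∈ window (t, z) <;> simp [*]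
  rw [lintegral_congr hmem, lintegral_indicator_one measurableSet_Ico, Real.volume_Ico,
    ← max_sub_min_eq_abs']
  congr 1
  ring

theorem lintegral_ofReal_one_sub_mul_exp {u : ℝ} (hu : 0 < u) (hu' : u ≤ 1) :
    ∫⁻ t in Set.Ioi 0, ENNReal.ofReal (1 - u * Real.exp t) =
      ENNReal.ofReal (-Real.log u - (1 - u)) := by
  have hT : 0 ≤ -Real.log u := neg_nonneg.2 (Real.log_nonpos hu.le hu')
  have hexp (t : ℝ) : 0 ≤ 1 - u * Real.exp t ↔ t ≤ -Real.log u := by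
    rw [sub_nonneg, ← le_div_iff₀' hu, ← Real.le_log_iff_exp_le (by positivity), one_div,
      Real.log_inv]
  have htail : ∫⁻ t in Set.Ioi (-Real.log u), ENNReal.ofReal (1 - u * Real.exp t) = 0 := by
    refine (setLIntegral_congr_fun measurableSet_Ioi fun t ht => ?_).trans (lintegral_zero)
    exact ENNReal.ofReal_of_nonpos (not_le.1 fun h => ht.not_ge ((hexp t).1 h)).le
  rw [← Set.Ioc_union_Ioi_eq_Ioi hT,
    lintegral_union measurableSet_Ioi (Set.Ioc_disjoint_Ioi le_rfl), htail, add_zero,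
    ← ofReal_integral_eq_lintegral_ofReal, ← intervalIntegral.integral_of_le hT]
  · have hint : ∫ t in (0 : ℝ)..-Real.log u, (1 - u * Real.exp t) = -Real.log u - (1 - u) := by
      rw [intervalIntegral.integral_sub intervalIntegrable_const
        (Continuous.intervalIntegrable (by fun_prop) _ _), intervalIntegral.integral_const,
        intervalIntegral.integral_const_mul, integral_exp, Real.exp_neg, Real.exp_log hu]
      simp [mul_sub, hu.ne']
    rw [hint]
  · exact (Continuous.integrableOn_Icc (by fun_prop)).mono_set Set.Ioc_subset_Icc_self
  · exact (ae_restrict_iff' measurableSet_Ioc).2 (.of_forall fun t ht => (hexp t).2 ht.2)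

theorem negLogDist_eq_lintegral_window (x y : unitInterval) :
    negLogDist (x, y) =
      ∫⁻ a, (window a).indicator 1 x * (window a).indicator 1 y ∂windowMeasure := by
  have hind (w : unitInterval) :
      Measurable fun a => (window a).indicator (1 : unitInterval → ℝ≥0∞) w :=
    (measurable_const (a := (1 : ℝ≥0∞))).indicator (measurable_prodMk_right measurableSet_window)
  have hscale (t : ℝ) : ENNReal.ofReal (Real.exp t) *
      ENNReal.ofReal (Real.exp (-t) - |(x : ℝ) - y|) =
        ENNReal.ofReal (1 - |(x : ℝ) - y| * Real.exp t) := by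
    rw [← ENNReal.ofReal_mul (Real.exp_pos t).le, mul_sub, ← Real.exp_add, add_neg_cancel,
      Real.exp_zero, mul_comm]
  rw [lintegral_windowMeasure (f := fun a => (window a).indicator 1 x * (window a).indicator 1 y)
    ((hind x).mul (hind y))]
  simp only [lintegral_window_mul_window, hscale, neg_zero, Real.exp_zero]
  rcases eq_or_ne x y with rfl | hxy
  · simp [negLogDist_self]
  · have hpos : 0 < |(x : ℝ) - y| := abs_pos.2 (sub_ne_zero.2 (Subtype.coe_injective.ne hxy))
    have hle : |(x : ℝ) - y| ≤ 1 := by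
      rw [abs_le]
      constructor <;> linarith [x.2.1, x.2.2, y.2.1, y.2.2]
    have hlog : negLogDist (x, y) = ENNReal.ofReal (-Real.log |(x : ℝ) - y|) := by
      rw [negLogDist, Subtype.edist_eq, edist_dist, Real.dist_eq, ENNReal.log_ofReal_of_pos hpos,
        ← EReal.coe_neg, EReal.toENNReal_of_ne_top (EReal.coe_ne_top _), EReal.toReal_coe]
    rw [lintegral_ofReal_one_sub_mul_exp hpos hle, hlog, ← ENNReal.ofReal_add _ (sub_nonneg.2 hle)]
    · ring_nf
    · linarith [Real.log_le_sub_one_of_pos hpos]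

theorem energy_negLogDist (ν : ProbabilityMeasure unitInterval) :
    energy negLogDist ν = ∫⁻ a, (ν : Measure unitInterval) (window a) ^ 2 ∂windowMeasure :=
  energy_eq_lintegral_sq measurableSet_window negLogDist_eq_lintegral_window ν

theorem ae_of_ae_windowMeasure {p : ℝ × ℝ → Prop} (h : ∀ᵐ a ∂windowMeasure, p a) :
    ∀ᵐ z, p (0, z) := by
  have hexp : Measurable fun t : ℝ => ENNReal.ofReal (Real.exp t) := by fun_prop
  have h0 := (ae_add_measure_iff.1
    ((ae_withDensity_iff hexp).1 (Measure.ae_ae_of_ae_prod h))).2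
  rw [ae_dirac_eq, eventually_pure] at h0
  exact h0 (by simp)

theorem eq_of_ae_measure_window_eq {ν ρ : ProbabilityMeasure unitInterval}
    (h : ∀ᵐ a ∂windowMeasure, ν (window a) = ρ (window a)) : ν = ρ := by
  have hdense := Measure.dense_of_ae (ae_of_ae_windowMeasure h)
  have hwindow {z : ℝ} (hz : z < 0) : window (0, z) = {x : unitInterval | (x : ℝ) ≤ z + 1} :=
    Set.ext fun x => by simp [window, hz.trans_le x.2.1]
  have htendsto (κ : ProbabilityMeasure unitInterval) (c : unitInterval) :
      Tendsto (fun t : ℝ => (κ : Measure unitInterval) {x : unitInterval | (x : ℝ) ≤ t})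
        (𝓝[>] (c : ℝ)) (𝓝 ((κ : Measure unitInterval) (Set.Iic c))) := by
    have hInter : Set.Iic c = ⋂ t > (c : ℝ), {x : unitInterval | (x : ℝ) ≤ t} := by
      ext x
      simpa using (forall_gt_imp_ge_iff_le_of_dense (a₁ := (x : ℝ)) (a₂ := c)).symm
    rw [hInter]
    exact tendsto_measure_biInter_gt
      (fun t _ => (measurableSet_le measurable_subtype_coe measurable_const).nullMeasurableSet)
      (fun s t _ hst x (hx : (x : ℝ) ≤ s) => hx.trans hst) ⟨c + 1, by simp, measure_ne_top _ _⟩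
  refine Subtype.ext (Measure.ext_of_Iic (ν : Measure unitInterval) ρ fun c => ?_)
  rcases eq_or_lt_of_le (show c ≤ 1 from c.2.2) with rfl | hc
  · rw [show Set.Iic (1 : unitInterval) = Set.univ from Set.Iic_top, measure_univ, measure_univ]
  refine tendsto_nhds_unique_of_frequently_eq (htendsto ν c) (htendsto ρ c)
    ((nhdsGT_basis (c : ℝ)).frequently_iff.2 fun b hb => ?_)
  obtain ⟨z, hz, hcz, hzb⟩ := hdense.exists_between
    (show (c : ℝ) - 1 < min b 1 - 1 from sub_lt_sub_right (lt_min hb hc) 1)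
  refine ⟨z + 1, ⟨by linarith, by linarith [min_le_left b 1]⟩, ?_⟩
  have hz' : z < 0 := by linarith [min_le_right b 1]
  simpa [← hwindow hz', ← ENNReal.coe_inj] using hz

theorem energy_minimizer_unique {ν ρ : ProbabilityMeasure unitInterval}
    (hν : energy negLogDist ν ≠ ∞)
    (hνmin : ∀ π : ProbabilityMeasure unitInterval, energy negLogDist ν ≤ energy negLogDist π)
    (hρmin : ∀ π : ProbabilityMeasure unitInterval, energy negLogDist ρ ≤ energy negLogDist π) :
    ν = ρ :=
  eq_of_ae_measure_window_eq <| ae_measure_eq_of_forall_energy_le measurableSet_window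
    negLogDist_eq_lintegral_window hν hνmin hρmin

theorem lintegral_volume_window_sq_le {t : ℝ} (ht : 0 ≤ t) :
    ∫⁻ z, (volume : Measure unitInterval) (window (t, z)) ^ 2 ≤
      2 * ENNReal.ofReal (Real.exp (-t)) ^ 2 := by
  have hwindow (z : ℝ) : (volume : Measure unitInterval) (window (t, z)) ^ 2 ≤
      (Set.Icc (-1 : ℝ) 1).indicator (fun _ => ENNReal.ofReal (Real.exp (-t)) ^ 2) z := by
    by_cases hz : z ∈ Set.Icc (-1 : ℝ) 1
    · rw [Set.indicator_of_mem hz]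
      gcongr
      calc volume (window (t, z)) ≤ volume (Set.Ioc z (z + Real.exp (-t))) := by
            rw [unitInterval.volume_apply]
            exact measure_mono (Set.image_subset_iff.2 fun x hx => hx)
        _ = ENNReal.ofReal (Real.exp (-t)) := by simp
    · have hempty : window (t, z) = ∅ := by
        refine Set.eq_empty_of_forall_notMem fun x hx => hz ⟨?_, hx.1.le.trans x.2.2⟩
        linarith [hx.2, x.2.1, Real.exp_le_one_iff.2 (neg_nonpos.2 ht)]
      simp [hempty]
  refine (lintegral_mono hwindow).trans_eq ?_
  rw [lintegral_indicator_const measurableSet_Icc, Real.volume_Icc, mul_comm]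
  norm_num

theorem exists_energy_ne_top :
    ∃ ν : ProbabilityMeasure unitInterval, energy negLogDist ν ≠ ∞ := by
  let lam : ProbabilityMeasure unitInterval := ⟨volume, inferInstance⟩
  have hinner {t : ℝ} (ht : t ∈ Set.Ioi (0 : ℝ)) :
      ENNReal.ofReal (Real.exp t) * ∫⁻ z, (volume : Measure unitInterval) (window (t, z)) ^ 2 ≤
        2 * ENNReal.ofReal (Real.exp (-t)) := by
    refine (mul_le_mul_right (lintegral_volume_window_sq_le (le_of_lt ht)) _).trans_eq ?_
    rw [sq, mul_left_comm, ← mul_assoc (ENNReal.ofReal _), ← ENNReal.ofReal_mul (Real.exp_pos t).le,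
      ← Real.exp_add, add_neg_cancel, Real.exp_zero, ENNReal.ofReal_one, one_mul]
  have hexp : ∫⁻ t in Set.Ioi (0 : ℝ), ENNReal.ofReal (Real.exp (-t)) = 1 := by
    rw [← ofReal_integral_eq_lintegral_ofReal (integrableOn_exp_neg_Ioi 0)
      (.of_forall fun t => (Real.exp_pos _).le), integral_exp_neg_Ioi_zero, ENNReal.ofReal_one]
  refine ⟨lam, ne_top_of_le_ne_top (b := 2 * 1 + 2 * 1) (by simp) ?_⟩
  have hm : Measurable fun a => (lam : Measure unitInterval) (window a) ^ 2 :=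
    (measurable_measure_prodMk_left measurableSet_window).pow_const 2
  rw [energy_negLogDist, lintegral_windowMeasure hm]
  refine add_le_add ((setLIntegral_mono' measurableSet_Ioi fun t ht => hinner ht).trans_eq ?_) ?_
  · rw [lintegral_const_mul _ (by fun_prop), hexp]
  · exact (lintegral_volume_window_sq_le le_rfl).trans_eq (by simp)

/-! ### Large deviation principles -/

section LargeDeviations

variable {E : Type*} [TopologicalSpace E] {Q : ℕ → Set E → ℝ≥0∞} {a : ℕ → ℝ} {J : E → EReal}

theorem IsGoodRateFunction.of_compactSpace [CompactSpace E] (hJ : LowerSemicontinuous J)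
    (hJ0 : ∀ x, 0 ≤ J x) : IsGoodRateFunction J :=
  ⟨hJ, hJ0, fun M => (hJ.isClosed_preimage M).isCompact⟩

theorem IsGoodRateFunction.iInf_pos {F : Set E} (hJ : IsGoodRateFunction J) (hF : IsClosed F)
    (hpos : ∀ x ∈ F, 0 < J x) : 0 < ⨅ x ∈ F, J x := by
  by_cases hne : ({x | J x ≤ ((1 : ℝ) : EReal)} ∩ F).Nonempty
  · obtain ⟨x, ⟨hx1, hxF⟩, hxmin⟩ := LowerSemicontinuousOn.exists_isMinOn hne
      ((hJ.2.2 1).inter_right hF) (hJ.1.lowerSemicontinuousOn _)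
    refine (hpos x hxF).trans_le (le_iInf₂ fun y hy => ?_)
    by_cases hy1 : J y ≤ ((1 : ℝ) : EReal)
    · exact hxmin ⟨hy1, hy⟩
    · exact hx1.trans (not_le.1 hy1).le
  · refine lt_of_lt_of_le (EReal.coe_pos.2 one_pos)
      (le_iInf₂ fun y hy => (not_le.1 fun hy1 => ?_).le)
    exact hne ⟨y, hy1, hy⟩

theorem SatisfiesLDP.tendsto_zero {F : Set E} (h : SatisfiesLDP Q a J)
    (ha : Tendsto a atTop atTop) (hF : IsClosed F) (hpos : ∀ x ∈ F, 0 < J x) :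
    Tendsto (fun n => Q n F) atTop (𝓝 0) := by
  obtain ⟨b, hb0, hb⟩ := EReal.lt_iff_exists_real_btwn.1 (h.1.iInf_pos hF hpos)
  have hlim : Tendsto (fun n => ENNReal.ofReal (Real.exp (-(a n * b)))) atTop (𝓝 0) := by
    rw [← ENNReal.ofReal_zero]
    exact (ENNReal.continuous_ofReal.tendsto 0).comp <|
      Real.tendsto_exp_neg_atTop_nhds_zero.comp (ha.atTop_mul_const (by exact_mod_cast hb0))
  have hlt := eventually_lt_of_limsup_lt ((h.2.2 F hF).trans_lt (EReal.neg_lt_neg_iff.2 hb))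
  refine tendsto_of_tendsto_of_tendsto_of_le_of_le' tendsto_const_nhds hlim
    (Eventually.of_forall fun _ => zero_le) ?_
  filter_upwards [hlt, ha.eventually_gt_atTop 0] with n hn han
  rw [← ENNReal.log_le_log_iff, ENNReal.log_ofReal_of_pos (Real.exp_pos _), Real.log_exp]
  have hle := hn.le
  rw [EReal.div_le_iff_le_mul (by exact_mod_cast han) (EReal.coe_ne_top _), ← EReal.coe_neg,
    ← EReal.coe_mul, mul_neg] at hle
  exact hle

theorem SatisfiesLDP.tendsto_one {O : Set E} (h : SatisfiesLDP Q a J) (ha : Tendsto a atTop atTop)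
    (hO : IsOpen O) (hpos : ∀ x ∉ O, 0 < J x) (hle : ∀ n, Q n O ≤ 1)
    (hcompl : ∀ n, 1 ≤ Q n O + Q n Oᶜ) : Tendsto (fun n => Q n O) atTop (𝓝 1) := by
  have hlim := ENNReal.Tendsto.sub (tendsto_const_nhds (x := (1 : ℝ≥0∞)))
    (h.tendsto_zero ha hO.isClosed_compl hpos) (Or.inl ENNReal.one_ne_top)
  rw [tsub_zero] at hlim
  exact tendsto_of_tendsto_of_tendsto_of_le_of_le hlim tendsto_const_nhds
    (fun n => tsub_le_iff_right.2 (hcompl n)) hle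

theorem SatisfiesLDP.comap {D : Type*} [TopologicalSpace D] {R : ℕ → Set D → ℝ≥0∞} {f : D → E}
    (h : SatisfiesLDP Q a J) (hf : IsInducing f) (hJ : ∀ y ∉ Set.range f, J y = ⊤)
    (hR : ∀ A, IsOpen A ∨ IsClosed A → ∀ᶠ n in atTop, R n (f ⁻¹' A) = Q n A) :
    SatisfiesLDP R a (J ∘ f) := by
  have hinf : ∀ A : Set E, ⨅ x ∈ f ⁻¹' A, (J ∘ f) x = ⨅ y ∈ A, J y := fun A => by
    refine le_antisymm (le_iInf₂ fun y hy => ?_) (le_iInf₂ fun x hx => iInf₂_le (f x) hx)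
    by_cases hyf : y ∈ Set.range f
    · obtain ⟨x, rfl⟩ := hyf
      exact iInf₂_le x hy
    · simp only [hJ y hyf, le_top]
  have hlog : ∀ A, IsOpen A ∨ IsClosed A →
      (fun n => ENNReal.log (R n (f ⁻¹' A)) / ((a n : ℝ) : EReal)) =ᶠ[atTop]
        fun n => ENNReal.log (Q n A) / ((a n : ℝ) : EReal) := fun A hA =>
    (hR A hA).mono fun n hn => by simp only [hn]
  obtain ⟨⟨hlsc, hnonneg, hcompact⟩, hopen, hclosed⟩ := h
  refine ⟨⟨LowerSemicontinuous.comp hlsc hf.continuous, fun x => hnonneg _, fun M => ?_⟩,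
    fun O hO => ?_, fun F hF => ?_⟩
  · refine (hf.isCompact_preimage_iff fun y hy => ?_).2 (hcompact M)
    by_contra hyf
    exact EReal.coe_ne_top M (top_le_iff.1 (hJ y hyf ▸ hy))
  · obtain ⟨A, hA, rfl⟩ := hf.isOpen_iff.1 hO
    rw [hinf, liminf_congr (hlog A (.inl hA))]
    exact hopen A hA
  · obtain ⟨A, hA, rfl⟩ := hf.isClosed_iff.1 hF
    rw [hinf, limsup_congr (hlog A (.inr hA))]
    exact hclosed A hA

end LargeDeviations

/-! ### The log-gas on the unit interval -/

section Gas

/-- The minimal logarithmic energy of a probability measure on the unit interval. -/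
def minEnergy : ℝ≥0∞ := ⨅ ν : ProbabilityMeasure unitInterval, energy negLogDist ν

/-- The law of the empirical measure of the normalised log-gas `∏_{i<j} |yᵢ - yⱼ|` on the unit
interval. -/
def gasProb (n : ℕ) (A : Set (ProbabilityMeasure unitInterval)) : ℝ≥0∞ :=
  gasMass n A / gasMass n Set.univ

/-- The rate function of the log-gas on the unit interval: half the excess energy. -/
def gasRate (ν : ProbabilityMeasure unitInterval) : EReal :=
  ((energy negLogDist ν - minEnergy) / 2 : ℝ≥0∞)

variable {ν ρ : ProbabilityMeasure unitInterval}

theorem lowerSemicontinuous_energy_negLogDist :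
    LowerSemicontinuous fun ν : ProbabilityMeasure unitInterval => energy negLogDist ν := by
  have hk : Continuous (negLogDist (X := unitInterval)) := continuous_negLogDist
  exact lowerSemicontinuous_energy hk

theorem minEnergy_le (ν : ProbabilityMeasure unitInterval) : minEnergy ≤ energy negLogDist ν :=
  iInf_le _ ν

theorem minEnergy_ne_top : minEnergy ≠ ∞ := by
  obtain ⟨ν, hν⟩ := exists_energy_ne_top
  exact ((minEnergy_le ν).trans_lt hν.lt_top).ne

theorem exists_energy_eq_minEnergy :
    ∃ ν : ProbabilityMeasure unitInterval, energy negLogDist ν = minEnergy := by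
  obtain ⟨ν, -, hν⟩ := LowerSemicontinuousOn.exists_isMinOn
    ⟨_, Set.mem_univ exists_energy_ne_top.choose⟩ isCompact_univ
    (lowerSemicontinuous_energy_negLogDist.lowerSemicontinuousOn _)
  exact ⟨ν, le_antisymm (le_iInf fun ρ => hν (Set.mem_univ ρ)) (minEnergy_le ν)⟩

theorem coe_ennreal_div_two (c : ℝ≥0∞) : ((c / 2 : ℝ≥0∞) : EReal) = (c : EReal) / 2 := by
  have hmul : (c : EReal) = ((c / 2 : ℝ≥0∞) : EReal) * 2 := by
    conv_lhs => rw [← ENNReal.div_mul_cancel two_ne_zero ENNReal.ofNat_ne_top (b := c),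
      EReal.coe_ennreal_mul]
    rfl
  exact ((EReal.div_eq_iff (EReal.coe_ne_bot 2) (EReal.coe_ne_top 2) two_ne_zero).2 hmul).symm

theorem minEnergy_div_two :
    (minEnergy : EReal) / 2 = (((minEnergy / 2).toReal : ℝ) : EReal) := by
  rw [EReal.coe_ennreal_toReal (ENNReal.div_ne_top minEnergy_ne_top two_ne_zero),
    coe_ennreal_div_two]

theorem gasRate_eq_sub (ν : ProbabilityMeasure unitInterval) :
    gasRate ν = (energy negLogDist ν : EReal) / 2 - (minEnergy : EReal) / 2 := by
  rw [gasRate, ENNReal.sub_div fun _ _ => two_ne_zero,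
    ENNReal.toEReal_sub (ENNReal.div_ne_top minEnergy_ne_top two_ne_zero)
      (ENNReal.div_le_div_right (minEnergy_le ν) 2), coe_ennreal_div_two, coe_ennreal_div_two]

theorem gasRate_nonneg (ν : ProbabilityMeasure unitInterval) : 0 ≤ gasRate ν :=
  EReal.coe_ennreal_nonneg _

theorem gasRate_eq_zero_iff : gasRate ν = 0 ↔ energy negLogDist ν = minEnergy := by
  rw [gasRate, EReal.coe_ennreal_eq_zero, ENNReal.div_eq_zero_iff, tsub_eq_zero_iff_le]
  simp [(minEnergy_le ν).ge_iff_eq']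

theorem lowerSemicontinuous_gasRate : LowerSemicontinuous gasRate := by
  have hcont : Continuous fun e : ℝ≥0∞ => (((e - minEnergy) / 2 : ℝ≥0∞) : EReal) :=
    continuous_coe_ennreal_ereal.comp <|
      (ENNReal.continuous_div_const 2 two_ne_zero).comp (ENNReal.continuous_sub_right minEnergy)
  refine hcont.comp_lowerSemicontinuous lowerSemicontinuous_energy_negLogDist fun a b h => ?_
  exact EReal.coe_ennreal_le_coe_ennreal_iff.2 (by gcongr)

theorem eq_of_gasRate_eq_zero (hν : gasRate ν = 0) (hρ : gasRate ρ = 0) : ν = ρ := by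
  rw [gasRate_eq_zero_iff] at hν hρ
  exact energy_minimizer_unique (hν ▸ minEnergy_ne_top) (fun π => hν ▸ minEnergy_le π)
    fun π => hρ ▸ minEnergy_le π

theorem log_gasProb_div (n : ℕ) (A : Set (ProbabilityMeasure unitInterval)) :
    ENNReal.log (gasProb n A) / (((n : ℝ) ^ 2 : ℝ) : EReal) =
      ENNReal.log (gasMass n A) / (((n : ℝ) ^ 2 : ℝ) : EReal) -
        ENNReal.log (gasMass n Set.univ) / (((n : ℝ) ^ 2 : ℝ) : EReal) := by
  rw [gasProb, ENNReal.div_eq_inv_mul, mul_comm, ENNReal.log_mul_add, ENNReal.log_inv,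
    EReal.add_div_of_nonneg_right (by exact_mod_cast sq_nonneg (n : ℝ)), div_eq_mul_inv (-_),
    neg_mul]
  rfl

theorem tendsto_log_gasMass_univ :
    Tendsto (fun n : ℕ => ENNReal.log (gasMass n Set.univ) / (((n : ℝ) ^ 2 : ℝ) : EReal)) atTop
      (𝓝 (-((minEnergy : EReal) / 2))) := by
  obtain ⟨ν, hν⟩ := exists_energy_eq_minEnergy
  refine tendsto_of_le_liminf_of_limsup_le ?_ ?_
  · rw [← hν]
    exact le_liminf_log_gasMass isOpen_univ (Set.mem_univ ν)
  · refine limsup_log_gasMass_le isClosed_univ fun ρ _ => ?_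
    exact EReal.div_le_div_right_of_nonneg (by norm_num) (by exact_mod_cast minEnergy_le ρ)

theorem satisfiesLDP_gasProb : SatisfiesLDP gasProb (fun n => (n : ℝ) ^ 2) gasRate := by
  let c : ℝ := (minEnergy / 2).toReal
  have hrate : ∀ ν, gasRate ν = (energy negLogDist ν : EReal) / 2 - (c : EReal) := fun ν => by
    rw [gasRate_eq_sub, minEnergy_div_two]
  have hnorm : Tendsto (fun n : ℕ => -(ENNReal.log (gasMass n Set.univ) /
      (((n : ℝ) ^ 2 : ℝ) : EReal))) atTop (𝓝 (c : EReal)) := by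
    simpa only [neg_neg, minEnergy_div_two] using tendsto_log_gasMass_univ.neg
  refine ⟨.of_compactSpace lowerSemicontinuous_gasRate gasRate_nonneg, fun O hO => ?_,
    fun F hF => ?_⟩ <;> simp only [log_gasProb_div, sub_eq_add_neg]
  · refine EReal.neg_le.2 (le_iInf₂ fun ν hν => EReal.neg_le.2 ?_)
    rw [hrate, EReal.neg_sub (.inr (EReal.coe_ne_bot c)) (.inr (EReal.coe_ne_top c))]
    refine le_trans ?_ EReal.le_liminf_add
    rw [hnorm.liminf_eq]
    exact add_le_add_left (le_liminf_log_gasMass hO hν) _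
  · refine (EReal.limsup_add_le ?_ ?_).trans ?_
    · exact .inr (hnorm.limsup_eq ▸ EReal.coe_ne_top c)
    · exact .inr (hnorm.limsup_eq ▸ EReal.coe_ne_bot c)
    rw [hnorm.limsup_eq]
    refine EReal.add_le_of_le_sub ?_
    rw [← EReal.neg_add (.inr (EReal.coe_ne_top c)) (.inr (EReal.coe_ne_bot c))]
    refine limsup_log_gasMass_le hF fun ν hν => EReal.add_le_of_le_sub ?_
    exact (iInf₂_le ν hν).trans_eq (hrate ν)

end Gas

/-! ### Conditional laws of the zeros -/

section Rate

variable {μ : ProbabilityMeasure ℂ}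

theorem exists_isOpen_pushUnit_mem_iff {U : Set (ProbabilityMeasure ℂ)} (hU : IsOpen U) :
    ∃ W : Set (ProbabilityMeasure unitInterval), IsOpen W ∧
      ∀ μ ∈ probOn negLine, pushUnit μ ∈ W ↔ μ ∈ U := by
  obtain ⟨W, hW, hWU⟩ := isInducing_pushUnit.isOpen_iff.1
    (hU.preimage (continuous_subtype_val (p := fun μ => μ ∈ probOn negLine)))
  exact ⟨W, hW, fun μ hμ => Set.ext_iff.1 hWU ⟨μ, hμ⟩⟩

theorem mem_classP_of_mem_probOn (hμ : μ ∈ probOn negLine) : μ ∈ classP := by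
  rw [classP, mem_closure_iff]
  intro U hU hμU
  obtain ⟨W, hW, hmem⟩ := exists_isOpen_pushUnit_mem_iff hU
  have hdense : Dense (Set.Ioo (0 : unitInterval) 1) := by
    rw [dense_iff_closure_eq, closure_Ioo zero_ne_one]
    exact Set.Icc_bot_top
  obtain ⟨n, hn, y, hy, hyW⟩ := exists_empMeasure_mem hW ⟨_, (hmem μ hμ).2 hμU⟩ hdense
  have : NeZero n := ⟨hn⟩
  have hy0 : ∀ i, y i ≠ 0 := fun i => (hy i).1.ne'
  have hneg : empMeasure (ofUnit ∘ y) ∈ probOn negLine :=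
    (empMeasure_mem_probOn_iff isClosed_negLine.measurableSet).2
      fun i => ofUnit_mem_negLine (hy0 i)
  have hpos : ∀ k ≤ n, 0 < (bernoulliPGF Finset.univ fun i => (y i : ℝ)).coeff k := fun k hk =>
    coeff_bernoulliPGF_pos (fun i _ => ⟨(hy i).1, (hy i).2⟩) (by simpa using hk)
  have hdeg : (bernoulliPGF Finset.univ fun i => (y i : ℝ)).natDegree = n :=
    natDegree_eq_of_le_of_coeff_ne_zero
      (by simpa using natDegree_bernoulliPGF_le Finset.univ fun i => (y i : ℝ)) (hpos n le_rfl).ne'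
  refine ⟨empMeasure (ofUnit ∘ y), (hmem _ hneg).1 ?_, _, ⟨hdeg.symm ▸ hn, hdeg.symm ▸ hpos⟩, ?_⟩
  · rwa [pushUnit_empMeasure_ofUnit hy0]
  · simpa only [map_one, one_mul] using empiricalMeasure_C_mul_bernoulliPGF one_ne_zero hy0

theorem rateI_eq (hμ : μ ∈ probOn negLine) :
    rateI μ = (energy negLogDist (pushUnit μ) : EReal) / 2 := by
  rw [rateI, if_pos (mem_classP_of_mem_probOn hμ), eintegral_logKernel hμ]

theorem exists_pushUnit_eq_of_energy_ne_top {ν : ProbabilityMeasure unitInterval}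
    (hν : energy negLogDist ν ≠ ∞) : ∃ μ ∈ probOn negLine, pushUnit μ = ν :=
  have hk : Continuous (negLogDist (X := unitInterval)) := continuous_negLogDist
  exists_pushUnit_eq
    (measure_singleton_eq_zero_of_energy_ne_top hk.measurable (negLogDist_self 0) hν)

theorem infRate_eq : infRate = (minEnergy : EReal) / 2 := by
  refine le_antisymm ?_ (le_iInf₂ fun μ hμ => ?_)
  · obtain ⟨ν, hν⟩ := exists_energy_eq_minEnergy
    obtain ⟨μ, hμ, rfl⟩ := exists_pushUnit_eq_of_energy_ne_top (hν ▸ minEnergy_ne_top)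
    rw [← hν, ← rateI_eq hμ]
    exact iInf₂_le μ hμ
  · rw [rateI_eq hμ]
    exact EReal.div_le_div_right_of_nonneg (by norm_num) (by exact_mod_cast minEnergy_le _)

theorem rateI_sub_infRate (hμ : μ ∈ probOn negLine) :
    rateI μ - infRate = gasRate (pushUnit μ) := by
  rw [rateI_eq hμ, infRate_eq, gasRate_eq_sub]

theorem rateI_eq_infRate_iff (hμ : μ ∈ probOn negLine) :
    rateI μ = infRate ↔ gasRate (pushUnit μ) = 0 := by
  rw [rateI_eq hμ, infRate_eq, gasRate_eq_zero_iff]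
  have hmono := EReal.strictMono_div_right_of_pos (b := 2) (by norm_num) (EReal.coe_ne_top 2)
  exact hmono.injective.eq_iff.trans EReal.coe_ennreal_eq_coe_ennreal_iff

theorem gasRate_eq_top_of_notMem_range {ν : ProbabilityMeasure unitInterval}
    (hν : ν ∉ Set.range fun μ : probOn negLine => pushUnit (μ : ProbabilityMeasure ℂ)) :
    gasRate ν = ⊤ := by
  by_cases h : energy negLogDist ν = ∞
  · rw [gasRate, h, ENNReal.top_sub minEnergy_ne_top,
      ENNReal.top_div_of_ne_top ENNReal.ofNat_ne_top, EReal.coe_ennreal_top]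
  · obtain ⟨μ, hμ, rfl⟩ := exists_pushUnit_eq_of_energy_ne_top h
    exact absurd ⟨⟨μ, hμ⟩, rfl⟩ hν

end Rate

section Conditional

theorem gasProb_le_one (n : ℕ) (A : Set (ProbabilityMeasure unitInterval)) : gasProb n A ≤ 1 :=
  ENNReal.div_le_of_le_mul (by simpa only [one_mul] using gasMass_mono (Set.subset_univ A))

theorem one_le_gasProb_add_compl (n : ℕ) (A : Set (ProbabilityMeasure unitInterval)) :
    1 ≤ gasProb n A + gasProb n Aᶜ := by
  rw [gasProb, gasProb, ← ENNReal.add_div,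
    ENNReal.le_div_iff_mul_le (.inl (gasMass_univ_ne_zero n)) (.inl (gasMass_univ_ne_top n)),
    one_mul]
  simp only [gasMass]
  refine (lintegral_mono_set fun y _ => ?_).trans (lintegral_union_le _ _ _)
  exact em _

theorem tendsto_gasProb_one {ν : ProbabilityMeasure unitInterval} (hν : gasRate ν = 0)
    {W : Set (ProbabilityMeasure unitInterval)} (hW : IsOpen W) (hνW : ν ∈ W) :
    Tendsto (fun n => gasProb n W) atTop (𝓝 1) := by
  refine satisfiesLDP_gasProb.tendsto_one
    ((tendsto_pow_atTop two_ne_zero).comp tendsto_natCast_atTop_atTop) hW (fun ρ hρ => ?_)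
    (gasProb_le_one · W) (one_le_gasProb_add_compl · W)
  refine (gasRate_nonneg ρ).lt_of_ne fun hzero => hρ ?_
  rwa [← eq_of_gasRate_eq_zero hν hzero.symm]

variable {Ω : Type*} [MeasurableSpace Ω] {P : Measure Ω} [IsProbabilityMeasure P]
  {r : ℝ} (hr : 0 < r) {ξ : ℕ → Ω → ℝ} (hlaw : ∀ j, HasLaw (ξ j) (expMeasure r) P)
  (hindep : iIndepFun ξ P) {S : Set ℂ} (hneg : negLine ⊆ S) (hreal : S ⊆ realLine)

include hr hlaw hindep hneg hreal

theorem measure_empL_mem_probOn (n : ℕ) [NeZero n] :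
    P {ω | empL ξ n ω ∈ probOn S} = gasMass n Set.univ := by
  simpa only [Set.mem_univ, and_true] using measure_event_eq_gasMass (n := n) hr hlaw hindep hneg
    hreal (A := Set.univ) .univ

theorem condProb_eq_gasProb {n : ℕ} [NeZero n] {A : Set (ProbabilityMeasure ℂ)}
    {W : Set (ProbabilityMeasure unitInterval)}
    (hW : MeasurableSet {y : Fin n → unitInterval | empMeasure y ∈ W})
    (hAW : ∀ μ ∈ probOn negLine, pushUnit μ ∈ W ↔ μ ∈ A) :
    condProb P ξ S n A = gasProb n W := by
  have hline : negLine ⊆ realLine := negLine_subset_realLine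
  have hnull := nullMeasurableSet_event (n := n) hr hlaw hindep hneg hreal (A := Set.univ) .univ
  have hae := (event_ae_eq (n := n) hr hlaw hindep hneg hreal Set.univ).trans
    (event_ae_eq hr hlaw hindep subset_rfl hline Set.univ).symm
  simp only [Set.mem_univ, and_true] at hnull hae
  rw [condProb, ProbabilityTheory.cond, Measure.smul_apply, smul_eq_mul,
    measure_empL_mem_probOn hr hlaw hindep hneg hreal, Measure.restrict_apply₀' hnull,
    measure_congr ((ae_eq_refl _).inter hae), gasProb, ENNReal.div_eq_inv_mul,
    ← measure_event_eq_gasMass hr hlaw hindep subset_rfl hline hW]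
  congr 2
  ext ω
  rw [Set.mem_inter_iff, and_comm]
  exact and_congr_right fun h => (hAW _ h).symm

theorem tendsto_condProb_one {μ : ProbabilityMeasure ℂ} (hμ : μ ∈ probOn negLine)
    (hmin : rateI μ = infRate) {U : Set (ProbabilityMeasure ℂ)} (hU : IsOpen U) (hμU : μ ∈ U) :
    Tendsto (fun n => condProb P ξ S n U) atTop (𝓝 1) := by
  obtain ⟨W, hW, hmem⟩ := exists_isOpen_pushUnit_mem_iff hU
  refine (tendsto_gasProb_one ((rateI_eq_infRate_iff hμ).1 hmin) hW
    ((hmem μ hμ).2 hμU)).congr' ?_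
  filter_upwards [eventually_ne_atTop 0] with n hn
  have : NeZero n := ⟨hn⟩
  exact (condProb_eq_gasProb hr hlaw hindep hneg hreal
    (hW.preimage continuous_empMeasure).measurableSet hmem).symm

omit hneg hreal

theorem satisfiesLDP_condProb : SatisfiesLDP (E := probOn negLine)
    (fun n A => condProb P ξ negLine n (Subtype.val '' A)) (fun n => (n : ℝ) ^ 2)
    (fun μ => rateI μ - infRate) := by
  have hrate : (fun μ : probOn negLine => rateI μ - infRate) =
      gasRate ∘ fun μ : probOn negLine => pushUnit (μ : ProbabilityMeasure ℂ) :=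
    funext fun μ => rateI_sub_infRate μ.2
  rw [hrate]
  refine satisfiesLDP_gasProb.comap isInducing_pushUnit (fun _ => gasRate_eq_top_of_notMem_range)
    fun W hW => ?_
  filter_upwards [eventually_ne_atTop 0] with n hn
  have : NeZero n := ⟨hn⟩
  refine condProb_eq_gasProb hr hlaw hindep subset_rfl negLine_subset_realLine
    ?_ fun μ hμ => ⟨fun h => ⟨⟨μ, hμ⟩, h, rfl⟩, ?_⟩
  · exact hW.elim (fun h => (h.preimage continuous_empMeasure).measurableSet)
      fun h => (h.preimage continuous_empMeasure).measurableSet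
  · rintro ⟨μ, h, rfl⟩
    exact h

end Conditional

theorem existsUnique_rateI_eq_infRate : ∃! μ, μ ∈ probOn negLine ∧ rateI μ = infRate := by
  obtain ⟨ν, hν⟩ := exists_energy_eq_minEnergy
  obtain ⟨μ, hμ, rfl⟩ := exists_pushUnit_eq_of_energy_ne_top (hν ▸ minEnergy_ne_top)
  have hmin := gasRate_eq_zero_iff.2 hν
  refine ⟨μ, ⟨hμ, (rateI_eq_infRate_iff hμ).2 hmin⟩, fun ρ ⟨hρ, hρmin⟩ => injOn_pushUnit hρ hμ ?_⟩
  exact eq_of_gasRate_eq_zero ((rateI_eq_infRate_iff hρ).1 hρmin) hmin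

end RandomZeros

end

open RandomZeros in
theorem theorem1p2_general {Ω : Type*} [MeasurableSpace Ω] (P : Measure Ω)
    [IsProbabilityMeasure P] {r : ℝ} (hr : 0 < r) (ξ : ℕ → Ω → ℝ)
    (hlaw : ∀ j, HasLaw (ξ j) (expMeasure r) P) (hindep : iIndepFun ξ P) :
    (∀ n : ℕ, 1 ≤ n → 0 < P {ω | empL ξ n ω ∈ probOn negLine}) ∧
    SatisfiesLDP (E := probOn negLine)
      (fun n A => condProb P ξ negLine n (Subtype.val '' A))
      (fun n => (n : ℝ) ^ 2)
      (fun μ => rateI μ - infRate) ∧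
    ∃ μR ∈ probOn negLine,
      rateI μR = infRate ∧
      (∀ ν ∈ probOn negLine, rateI ν = infRate → ν = μR) ∧
      (∀ U : Set (ProbabilityMeasure ℂ), IsOpen U → μR ∈ U →
        Tendsto (fun n => condProb P ξ negLine n U) atTop (𝓝 1) ∧
        Tendsto (fun n => condProb P ξ realLine n U) atTop (𝓝 1)) := by
  obtain ⟨μR, ⟨hμR, hmin⟩, hunique⟩ := existsUnique_rateI_eq_infRate
  have hline : negLine ⊆ realLine := negLine_subset_realLine
  refine ⟨fun n hn => ?_, satisfiesLDP_condProb hr hlaw hindep, μR, hμR, hmin,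
    fun ν hν h => hunique ν ⟨hν, h⟩, fun U hU hμU => ⟨?_, ?_⟩⟩
  · have : NeZero n := NeZero.of_pos hn
    rw [measure_empL_mem_probOn hr hlaw hindep subset_rfl hline]
    exact pos_iff_ne_zero.2 (gasMass_univ_ne_zero n)
  · exact tendsto_condProb_one hr hlaw hindep subset_rfl hline hμR hmin hU hμU
  · exact tendsto_condProb_one hr hlaw hindep hline subset_rfl hμR hmin hU hμU

theorem theorem1p2 {Ω : Type*} [MeasurableSpace Ω] (P : Measure Ω) [IsProbabilityMeasure P]
    (ξ : ℕ → Ω → ℝ) (hmeas : ∀ j, Measurable (ξ j))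
    (hlaw : ∀ j, HasLaw (ξ j) (expMeasure 1) P) (hindep : iIndepFun ξ P) :
    (∀ n : ℕ, 1 ≤ n → 0 < P {ω | RandomZeros.empL ξ n ω ∈ RandomZeros.probOn RandomZeros.negLine}) ∧
    RandomZeros.SatisfiesLDP (E := RandomZeros.probOn RandomZeros.negLine)
      (fun n A => RandomZeros.condProb P ξ RandomZeros.negLine n (Subtype.val '' A))
      (fun n => (n : ℝ) ^ 2)
      (fun μ => RandomZeros.rateI μ - RandomZeros.infRate) ∧
    ∃ μR ∈ RandomZeros.probOn RandomZeros.negLine,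
      RandomZeros.rateI μR = RandomZeros.infRate ∧
      (∀ ν ∈ RandomZeros.probOn RandomZeros.negLine,
        RandomZeros.rateI ν = RandomZeros.infRate → ν = μR) ∧
      (∀ U : Set (ProbabilityMeasure ℂ), IsOpen U → μR ∈ U →
        Tendsto (fun n => RandomZeros.condProb P ξ RandomZeros.negLine n U) atTop (𝓝 1) ∧
        Tendsto (fun n => RandomZeros.condProb P ξ RandomZeros.realLine n U) atTop (𝓝 1)) :=
  theorem1p2_general P one_pos ξ hlaw hindep
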